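/- Let $M$ be a smooth (second countable, Hausdorff, finite-dimensional) manifold of positive dimension, let $G$ be a Lie group whose Lie algebra $\mathfrak g$ is semisimple (i.e. has zero radical), and let $\pi:P\to M$ be a smooth principal $G$-bundle. Let $\mathcal A=\Gamma(TP/G)=\mathfrak X_G(P)$ be the Lie algebra of sections of the Atiyah algebroid of $P$, that is, of $G$-invariant smooth vector fields on $P$, let $\pi_*:\mathcal A\to\mathfrak X(M)$ be the anchor, and let $\mathcal K=\ker\pi_*$, a Lie ideal of $\mathcal A$. For $m\in M$ put $\mathcal A_m=\{a\in\mathcal A:(\pi_*a)_m=0\}$ and $\mathcal K(m)=\{k\in\mathcal K:k_m=0\}$. A maximal finite-codimensional Lie subalgebra (Lie ideal) is a proper Lie subalgebra (Lie ideal) of finite codimension that is not strictly contained in another proper one of finite codimension. A Lie ideal $\mathcal K_0$ of $\mathcal K$ is normalized by a Lie subalgebra $\mathcal T$ of $\mathcal A$ if $[\mathcal T,\mathcal K_0]\subset\mathcal K_0$, i.e. if $\mathcal T$ lies in the normalizer $N(\mathcal A,\mathcal K_0)=\{a\in\mathcal A:[a,\mathcal K_0]\subset\mathcal K_0\}$.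 Then each $\mathcal A_m$, $m\in M$, is a maximal finite-codimensional Lie subalgebra of $\mathcal A$. Conversely, for every maximal finite-codimensional Lie subalgebra $\mathcal T$ of $\mathcal A$ there is a unique $m\in M$ with $\mathcal T=\mathcal A_m$, and for this $m$ the intersection of all maximal finite-codimensional Lie ideals of $\mathcal K$ that are normalized by $\mathcal T$ is exactly $\mathcal K(m)$ (the intersection of the empty family being $\mathcal K$). Moreover, the normalizer in $\mathcal A$ of each of these ideals is exactly $\mathcal T=\mathcal A_m$. -/

import Mathlib

open scoped Manifold ContDiff Topology

set_option linter.unusedSectionVars false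

noncomputable section AtiyahDefinitions

open Set Filter VectorField

theorem completeSpace_of_finiteDimensional_real (E : Type*) [NormedAddCommGroup E] [NormedSpace ℝ E]
    [FiniteDimensional ℝ E] : CompleteSpace E := FiniteDimensional.complete ℝ E

attribute [instance] completeSpace_of_finiteDimensional_real

instance leInfty_minSmoothness_two : ENat.LEInfty (minSmoothness ℝ 2) := by
  rw [minSmoothness_of_isRCLikeNormedField]; infer_instance

instance leInfty_minSmoothness_three : ENat.LEInfty (minSmoothness ℝ 3) := by
  rw [minSmoothness_of_isRCLikeNormedField]; infer_instance

/-- The space `𝔛(M)` of smooth vector fields on a smooth manifold `M` without boundary, modelled on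
`E`. -/
abbrev SmoothVectorField (E : Type*) [NormedAddCommGroup E] [NormedSpace ℝ E]
    (M : Type*) [TopologicalSpace M] [ChartedSpace E M] [IsManifold 𝓘(ℝ, E) ∞ M] :=
  ContMDiffSection 𝓘(ℝ, E) E ∞ (TangentSpace 𝓘(ℝ, E) : M → Type _)

namespace SmoothVectorField

section LieAlgebra

variable {E : Type*} [NormedAddCommGroup E] [NormedSpace ℝ E] [FiniteDimensional ℝ E]
  {M : Type*} [TopologicalSpace M] [ChartedSpace E M] [IsManifold 𝓘(ℝ, E) ∞ M]

/-- The Lie bracket of vector fields. -/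
instance : Bracket (SmoothVectorField E M) (SmoothVectorField E M) where
  bracket X Y := ⟨mlieBracket 𝓘(ℝ, E) X Y, by
    have : IsManifold 𝓘(ℝ, E) (((⊤ : ℕ∞) : ℕ∞ω) + 1) M := by
      rw [show (((⊤ : ℕ∞) : ℕ∞ω) + 1) = ∞ from rfl]; infer_instance
    exact ContDiff.mlieBracket_vectorField (n := ⊤) (m := ⊤) X.contMDiff Y.contMDiff
      (by rw [minSmoothness_of_isRCLikeNormedField]; rfl)⟩

theorem lie_apply (X Y : SmoothVectorField E M) (x : M) :
    ⁅X, Y⁆ x = mlieBracket 𝓘(ℝ, E) X Y x := rfl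

instance : LieRing (SmoothVectorField E M) where
  add_lie X Y Z := by
    ext x
    exact mlieBracket_add_left X.mdifferentiableAt Y.mdifferentiableAt
  lie_add X Y Z := by
    ext x
    exact mlieBracket_add_right Y.mdifferentiableAt Z.mdifferentiableAt
  lie_self X := by
    ext x
    simp [lie_apply]
  leibniz_lie X Y Z := by
    ext x
    exact leibniz_identity_mlieBracket_apply
      (X.contMDiff.of_le ENat.LEInfty.out x) (Y.contMDiff.of_le ENat.LEInfty.out x)
      (Z.contMDiff.of_le ENat.LEInfty.out x)

instance : LieAlgebra ℝ (SmoothVectorField E M) where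
  lie_smul c X Y := by
    ext x
    exact mlieBracket_const_smul_right Y.mdifferentiableAt

end LieAlgebra
end SmoothVectorField

/-- Lie brackets of related vector fields are related, in vector spaces. -/
theorem lieBracket_related {E E' : Type*} [NormedAddCommGroup E] [NormedSpace ℝ E]
   [NormedAddCommGroup E'] [NormedSpace ℝ E'] {F : E → E'} {X Y : E → E} {v w : E' → E'} {x : E}
   (hF : ContDiffAt ℝ 2 F x) (hX : DifferentiableAt ℝ X x) (hY : DifferentiableAt ℝ Y x)
   (hv : DifferentiableAt ℝ v (F x)) (hw : DifferentiableAt ℝ w (F x))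
   (hXv : ∀ᶠ y in 𝓝 x, fderiv ℝ F y (X y) = v (F y))
   (hYw : ∀ᶠ y in 𝓝 x, fderiv ℝ F y (Y y) = w (F y)) :
   fderiv ℝ F x (lieBracket ℝ X Y x) = lieBracket ℝ v w (F x) := by
  have hF1 : DifferentiableAt ℝ F x := hF.differentiableAt (by simp)
  have hdF : DifferentiableAt ℝ (fderiv ℝ F) x :=
    (hF.fderiv_right (m := 1) (by norm_num)).differentiableAt (by simp)
  have key : ∀ {Z : E → E} {z : E' → E'}, DifferentiableAt ℝ Z x → DifferentiableAt ℝ z (F x) →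
      (∀ᶠ y in 𝓝 x, fderiv ℝ F y (Z y) = z (F y)) → ∀ a : E,
      fderiv ℝ (fderiv ℝ F) x a (Z x) + fderiv ℝ F x (fderiv ℝ Z x a)
        = fderiv ℝ z (F x) (fderiv ℝ F x a) := by
    intro Z z hZ hz h a
    have h1 := (hdF.hasFDerivAt.clm_apply hZ.hasFDerivAt).congr_of_eventuallyEq
      (h.mono fun y hy => hy.symm)
    have h2 := hz.hasFDerivAt.comp x hF1.hasFDerivAt
    have := congrArg (fun L => L a) (h1.unique h2)
    simpa [add_comm] using this
  have hs := hF.isSymmSndFDerivAt (by simp)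
  have e1 := key hX hv hXv (Y x)
  have e2 := key hY hw hYw (X x)
  rw [hYw.self_of_nhds] at e1
  rw [hXv.self_of_nhds] at e2
  rw [lieBracket, lieBracket, map_sub, ← e1, ← e2, hs (X x) (Y x)]
  abel

section Related

variable {E : Type*} [NormedAddCommGroup E] [NormedSpace ℝ E] [FiniteDimensional ℝ E]
  {M : Type*} [TopologicalSpace M] [ChartedSpace E M] [IsManifold 𝓘(ℝ, E) ∞ M]
  {E' : Type*} [NormedAddCommGroup E'] [NormedSpace ℝ E'] [FiniteDimensional ℝ E']
  {M' : Type*} [TopologicalSpace M'] [ChartedSpace E' M'] [IsManifold 𝓘(ℝ, E') ∞ M']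

/-- `X` and `v` are `f`-related: `T_x f (X_x) = v_{f(x)}` for all `x`. -/
def SmoothVectorField.Related (f : M → M') (X : SmoothVectorField E M)
    (v : SmoothVectorField E' M') : Prop :=
  ∀ x : M, mfderiv 𝓘(ℝ, E) 𝓘(ℝ, E') f x (X x) = v (f x)

/-- The local representative of a vector field in the preferred chart at `x₀`. -/
def SmoothVectorField.localRep (X : SmoothVectorField E M) (x₀ : M) (y : E) : E :=
  mpullbackWithin 𝓘(ℝ, E) 𝓘(ℝ, E) (extChartAt 𝓘(ℝ, E) x₀).symm X (range 𝓘(ℝ, E)) y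

theorem SmoothVectorField.localRep_chart (X : SmoothVectorField E M) (x₀ q : M)
    (hq : q ∈ (extChartAt 𝓘(ℝ, E) x₀).source) :
    X.localRep x₀ (extChartAt 𝓘(ℝ, E) x₀ q)
      = mfderiv 𝓘(ℝ, E) 𝓘(ℝ, E) (extChartAt 𝓘(ℝ, E) x₀) q (X q) := by
  have h1 := (extChartAt 𝓘(ℝ, E) x₀).map_source hq
  have h2 := (extChartAt 𝓘(ℝ, E) x₀).left_inv hq
  have hinv := isInvertible_mfderivWithin_extChartAt_symm (I := 𝓘(ℝ, E)) h1
  have := mfderivWithin_extChartAt_symm_comp_mfderiv_extChartAt' (I := 𝓘(ℝ, E)) hq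
  have h3 : mfderivWithin 𝓘(ℝ, E) 𝓘(ℝ, E) (extChartAt 𝓘(ℝ, E) x₀).symm (range 𝓘(ℝ, E))
      (extChartAt 𝓘(ℝ, E) x₀ q) (mfderiv 𝓘(ℝ, E) 𝓘(ℝ, E) (extChartAt 𝓘(ℝ, E) x₀) q (X q)) = X q :=
    congrArg (fun L => L (X q)) this
  have h4 : (X ((extChartAt 𝓘(ℝ, E) x₀).symm (extChartAt 𝓘(ℝ, E) x₀ q)) : E) = X q := by rw [h2]
  refine hinv.inverse_apply_eq.2 ?_
  exact h4.trans h3.symm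

theorem SmoothVectorField.differentiableAt_localRep (X : SmoothVectorField E M) (x₀ : M) :
    DifferentiableAt ℝ (X.localRep x₀) (extChartAt 𝓘(ℝ, E) x₀ x₀) := by
  have h := (X.mdifferentiableAt (x := x₀)).mdifferentiableWithinAt (s := univ)
  have h' := h.differentiableWithinAt_mpullbackWithin_vectorField
  have e : ((extChartAt 𝓘(ℝ, E) x₀).symm ⁻¹' univ ∩ range 𝓘(ℝ, E)) = univ := by simp
  rw [e] at h'
  exact differentiableWithinAt_univ.1 h'

theorem SmoothVectorField.mfderiv_chart_lie (X Y : SmoothVectorField E M) (x₀ : M) :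
    mfderiv 𝓘(ℝ, E) 𝓘(ℝ, E) (extChartAt 𝓘(ℝ, E) x₀) x₀ (⁅X, Y⁆ x₀)
      = lieBracket ℝ (X.localRep x₀) (Y.localRep x₀) (extChartAt 𝓘(ℝ, E) x₀ x₀) := by
  have hinv := isInvertible_mfderiv_extChartAt (I := 𝓘(ℝ, E))
    (mem_extChartAt_source (I := 𝓘(ℝ, E)) x₀)
  have e : ((extChartAt 𝓘(ℝ, E) x₀).symm ⁻¹' univ ∩ range 𝓘(ℝ, E)) = univ := by simp
  have h1 : lieBracketWithin ℝ (X.localRep x₀) (Y.localRep x₀)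
      ((extChartAt 𝓘(ℝ, E) x₀).symm ⁻¹' univ ∩ range 𝓘(ℝ, E)) (extChartAt 𝓘(ℝ, E) x₀ x₀) =
      lieBracket ℝ (X.localRep x₀) (Y.localRep x₀) (extChartAt 𝓘(ℝ, E) x₀ x₀) := by
    rw [e, lieBracketWithin_univ]
  exact (hinv.self_apply_inverse _).trans h1

/-- Lie brackets of related vector fields are related. -/
theorem SmoothVectorField.Related.lie {f : M → M'} (hf : ContMDiff 𝓘(ℝ, E) 𝓘(ℝ, E') ∞ f)
    {X Y : SmoothVectorField E M} {v w : SmoothVectorField E' M'}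
    (hX : X.Related f v) (hY : Y.Related f w) : Related f ⁅X, Y⁆ ⁅v, w⁆ := by
  intro x₀
  let φ := extChartAt 𝓘(ℝ, E) x₀
  let ψ := extChartAt 𝓘(ℝ, E') (f x₀)
  let F : E → E' := ψ ∘ f ∘ φ.symm
  have hx₀ : x₀ ∈ φ.source := mem_extChartAt_source x₀
  have hFx₀ : F (φ x₀) = ψ (f x₀) := by simp [F, φ.left_inv hx₀]
  have hF : ContDiffAt ℝ ∞ F (φ x₀) := by
    have := (contMDiffAt_iff.1 (hf x₀)).2
    exact contDiffWithinAt_univ.1 (by simpa using! this)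
  have hFev : ∀ᶠ q in 𝓝 x₀, ContDiffAt ℝ 1 F (φ q) :=
    (continuousAt_extChartAt (I := 𝓘(ℝ, E)) x₀).eventually
      ((hF.of_le (m := 1) (by norm_cast)).eventually (by simp))
  have hsrc : ∀ᶠ q in 𝓝 x₀, q ∈ φ.source ∧ f q ∈ ψ.source :=
    Filter.Eventually.and (extChartAt_source_mem_nhds (I := 𝓘(ℝ, E)) x₀)
      (hf.continuous.continuousAt.eventually (extChartAt_source_mem_nhds (I := 𝓘(ℝ, E')) (f x₀)))
  have hD : ∀ᶠ q in 𝓝 x₀, ∀ a : TangentSpace 𝓘(ℝ, E) q,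
      fderiv ℝ F (φ q) (mfderiv 𝓘(ℝ, E) 𝓘(ℝ, E) φ q a)
        = mfderiv 𝓘(ℝ, E') 𝓘(ℝ, E') ψ (f q) (mfderiv 𝓘(ℝ, E) 𝓘(ℝ, E') f q a) := by
    filter_upwards [hFev, hsrc.eventually_nhds] with q hFq hq a
    obtain ⟨hq1, hq2⟩ := hq.self_of_nhds
    have d1 : HasMFDerivAt 𝓘(ℝ, E) 𝓘(ℝ, E) φ q (mfderiv 𝓘(ℝ, E) 𝓘(ℝ, E) φ q) :=
      (mdifferentiableAt_extChartAt (by simpa [φ] using hq1)).hasMFDerivAt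
    have d2 : HasMFDerivAt 𝓘(ℝ, E') 𝓘(ℝ, E') ψ (f q) (mfderiv 𝓘(ℝ, E') 𝓘(ℝ, E') ψ (f q)) :=
      (mdifferentiableAt_extChartAt (by simpa [ψ] using hq2)).hasMFDerivAt
    have d3 := (hf.mdifferentiableAt (x := q) (by simp)).hasMFDerivAt
    have d4 : HasMFDerivAt 𝓘(ℝ, E) 𝓘(ℝ, E') F (φ q) (fderiv ℝ F (φ q)) :=
      (hFq.differentiableAt (by simp)).hasFDerivAt.hasMFDerivAt
    have d5 := d4.comp q d1
    have d6 := d2.comp q d3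
    have d7 := d6.congr_of_eventuallyEq (f₁ := F ∘ φ) (by
      filter_upwards [hq] with p hp
      simp [F, φ.left_inv hp.1])
    exact congrArg (fun L => L a) (hasMFDerivAt_unique d5 d7)
  have hrel : ∀ {Z : SmoothVectorField E M} {z : SmoothVectorField E' M'}, Z.Related f z →
      ∀ᶠ y in 𝓝 (φ x₀), fderiv ℝ F y (Z.localRep x₀ y) = z.localRep (f x₀) (F y) := by
    intro Z z hZ
    have h : ∀ᶠ q in 𝓝 x₀, fderiv ℝ F (φ q) (Z.localRep x₀ (φ q))
        = z.localRep (f x₀) (F (φ q)) := by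
      filter_upwards [hD, hsrc] with q hq hs
      have e1 : F (φ q) = ψ (f q) := by simp [F, φ.left_inv hs.1]
      rw [e1]
      refine (congrArg (fderiv ℝ F (φ q)) (Z.localRep_chart x₀ q hs.1)).trans ?_
      refine (hq (Z q)).trans ?_
      refine Eq.trans ?_ (z.localRep_chart (f x₀) (f q) hs.2).symm
      exact congrArg (mfderiv 𝓘(ℝ, E') 𝓘(ℝ, E') ψ (f q)) (hZ q)
    have hc : Tendsto φ.symm (𝓝 (φ x₀)) (𝓝 x₀) := by
      have := continuousAt_extChartAt_symm (I := 𝓘(ℝ, E)) x₀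
      rw [ContinuousAt, φ.left_inv hx₀] at this
      exact this
    filter_upwards [hc.eventually h, extChartAt_target_mem_nhds (I := 𝓘(ℝ, E)) x₀] with y hy hyt
    rwa [φ.right_inv hyt] at hy
  have main := lieBracket_related (F := F) (x := φ x₀) (hF.of_le (by norm_cast))
    (X.differentiableAt_localRep x₀) (Y.differentiableAt_localRep x₀)
    (v := v.localRep (f x₀)) (w := w.localRep (f x₀))
    (by rw [hFx₀]; exact v.differentiableAt_localRep _)
    (by rw [hFx₀]; exact w.differentiableAt_localRep _) (hrel hX) (hrel hY)
  have hinv := isInvertible_mfderiv_extChartAt (I := 𝓘(ℝ, E'))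
    (mem_extChartAt_source (I := 𝓘(ℝ, E')) (f x₀))
  apply hinv.injective
  refine (hD.self_of_nhds (⁅X, Y⁆ x₀)).symm.trans ?_
  refine (congrArg (fderiv ℝ F (φ x₀)) (X.mfderiv_chart_lie Y x₀)).trans ?_
  refine main.trans ?_
  rw [hFx₀]
  exact (v.mfderiv_chart_lie w (f x₀)).symm

end Related

section FiniteCodim

variable {L : Type*} [LieRing L] [LieAlgebra ℝ L]

/-- A maximal finite-codimensional Lie subalgebra: a proper Lie subalgebra of finite codimension that
is not strictly contained in any other one. -/
def LieSubalgebra.IsMaximalFiniteCodim (T : LieSubalgebra ℝ L) : Prop :=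
  T ≠ ⊤ ∧ Module.Finite ℝ (L ⧸ T.toSubmodule) ∧
    ∀ T' : LieSubalgebra ℝ L, T' ≠ ⊤ → Module.Finite ℝ (L ⧸ T'.toSubmodule) → ¬ T < T'

/-- A maximal finite-codimensional Lie ideal: a proper Lie ideal of finite codimension that is not
strictly contained in any other one. -/
def LieIdeal.IsMaximalFiniteCodim (J : LieIdeal ℝ L) : Prop :=
  J ≠ ⊤ ∧ Module.Finite ℝ (L ⧸ J.toSubmodule) ∧
    ∀ J' : LieIdeal ℝ L, J' ≠ ⊤ → Module.Finite ℝ (L ⧸ J'.toSubmodule) → ¬ J < J'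

/-- For a Lie ideal `I` of `L` and a Lie ideal `J` of `I`, the normalizer of `J` in `L`, i.e. the Lie
subalgebra `{a ∈ L | [a, J] ⊆ J}` of `L`. -/
def LieIdeal.ambientNormalizer (I : LieIdeal ℝ L) (J : LieIdeal ℝ I) : LieSubalgebra ℝ L :=
  ((LieIdeal.toLieSubalgebra ℝ I J).map I.incl).normalizer

theorem LieIdeal.mem_ambientNormalizer (I : LieIdeal ℝ L) (J : LieIdeal ℝ I) (a : L) :
    a ∈ I.ambientNormalizer J ↔ ∀ k : I, k ∈ J → ∃ k' : I, k' ∈ J ∧ (k' : L) = ⁅a, (k : L)⁆ := by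
  simp [ambientNormalizer, LieSubalgebra.mem_normalizer_iff]

end FiniteCodim

/-- A smooth principal `G`-bundle `P → M`: a smooth right action of `G` on `P` and a smooth projection
that is invariant under it, such that around every point of `M` there is a `G`-equivariant
diffeomorphism `π⁻¹(U) ≃ U × G` over `U`. -/
structure SmoothPrincipalBundle
    (EM EG EP : Type*) [NormedAddCommGroup EM] [NormedSpace ℝ EM]
    [NormedAddCommGroup EG] [NormedSpace ℝ EG] [NormedAddCommGroup EP] [NormedSpace ℝ EP]
    (M G P : Type*) [TopologicalSpace M] [ChartedSpace EM M]
    [TopologicalSpace G] [ChartedSpace EG G] [Group G]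
    [TopologicalSpace P] [ChartedSpace EP P] where
  proj : P → M
  act : P → G → P
  act_one : ∀ u, act u 1 = u
  act_mul : ∀ u g h, act u (g * h) = act (act u g) h
  proj_act : ∀ u g, proj (act u g) = proj u
  contMDiff_proj : ContMDiff 𝓘(ℝ, EP) 𝓘(ℝ, EM) ∞ proj
  contMDiff_act : ContMDiff (𝓘(ℝ, EP).prod 𝓘(ℝ, EG)) 𝓘(ℝ, EP) ∞ fun p : P × G => act p.1 p.2
  exists_trivialization : ∀ m : M, ∃ e : Bundle.Trivialization G proj, m ∈ e.baseSet ∧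
    ContMDiffOn 𝓘(ℝ, EP) (𝓘(ℝ, EM).prod 𝓘(ℝ, EG)) ∞ e e.source ∧
    ContMDiffOn (𝓘(ℝ, EM).prod 𝓘(ℝ, EG)) 𝓘(ℝ, EP) ∞ e.toOpenPartialHomeomorph.symm e.target ∧
    ∀ u g, proj u ∈ e.baseSet → (e (act u g)).2 = (e u).2 * g

namespace SmoothPrincipalBundle

variable {EM EG EP : Type*} [NormedAddCommGroup EM] [NormedSpace ℝ EM] [FiniteDimensional ℝ EM]
  [NormedAddCommGroup EG] [NormedSpace ℝ EG]
  [NormedAddCommGroup EP] [NormedSpace ℝ EP] [FiniteDimensional ℝ EP]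
  {M G P : Type*} [TopologicalSpace M] [ChartedSpace EM M] [IsManifold 𝓘(ℝ, EM) ∞ M]
  [TopologicalSpace G] [ChartedSpace EG G] [Group G]
  [TopologicalSpace P] [ChartedSpace EP P] [IsManifold 𝓘(ℝ, EP) ∞ P]
  (B : SmoothPrincipalBundle EM EG EP M G P)

theorem contMDiff_act_right (g : G) : ContMDiff 𝓘(ℝ, EP) 𝓘(ℝ, EP) ∞ fun u => B.act u g :=
  B.contMDiff_act.comp (contMDiff_id.prodMk contMDiff_const)

theorem proj_surjective : Function.Surjective B.proj := fun m => by
  obtain ⟨e, hm, -⟩ := B.exists_trivialization m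
  exact ⟨e.toOpenPartialHomeomorph.symm (m, 1), e.proj_symm_apply' hm⟩

theorem exists_act_eq {u u' : P} (h : B.proj u = B.proj u') : ∃ g, B.act u g = u' := by
  obtain ⟨e, hm, -, -, he⟩ := B.exists_trivialization (B.proj u)
  refine ⟨(e u).2⁻¹ * (e u').2, ?_⟩
  have hu : B.act u ((e u).2⁻¹ * (e u').2) ∈ e.source := by
    rw [e.mem_source, B.proj_act]; exact hm
  have hu' : u' ∈ e.source := by rw [e.mem_source, ← h]; exact hm
  apply e.injOn hu hu'
  apply Prod.ext
  · exact (e.coe_fst hu).trans ((B.proj_act _ _).trans (h.trans (e.coe_fst hu').symm))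
  · exact (he _ _ hm).trans (mul_inv_cancel_left _ _)

/-- The Lie algebra `𝒜 = Γ(TP/G) = 𝔛_G(P)` of sections of the Atiyah algebroid: the Lie algebra of
the `G`-invariant vector fields on `P`, i.e. those with `T_u r_g (X_u) = X_{u.g}` for all `u`, `g`. The
value `X_m` at `m ∈ M` of the section given by `X` is the class of the vectors `X_u`, `π(u) = m`. -/
def atiyahAlgebra : LieSubalgebra ℝ (SmoothVectorField EP P) where
  carrier := {X | ∀ g, SmoothVectorField.Related (fun u => B.act u g) X X}
  zero_mem' g u := by simp
  add_mem' {X Y} hX hY g u := by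
    have h1 := hX g u
    have h2 := hY g u
    exact (map_add _ _ _).trans (congrArg₂ (· + ·) h1 h2)
  smul_mem' c X hX g u := (map_smul _ c _).trans (congrArg (c • ·) (hX g u))
  lie_mem' {X Y} hX hY g := (hX g).lie (B.contMDiff_act_right g) (hY g)

theorem exists_anchor (X : B.atiyahAlgebra) :
    ∃ v : SmoothVectorField EM M, (X : SmoothVectorField EP P).Related B.proj v := by
  have hcoh : ∀ u u' : P, B.proj u = B.proj u' →
      (mfderiv 𝓘(ℝ, EP) 𝓘(ℝ, EM) B.proj u (X.1 u) : EM)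
        = mfderiv 𝓘(ℝ, EP) 𝓘(ℝ, EM) B.proj u' (X.1 u') := by
    intro u u' h
    obtain ⟨g, rfl⟩ := B.exists_act_eq h
    have hg : MDifferentiableAt 𝓘(ℝ, EP) 𝓘(ℝ, EP) (fun u => B.act u g) u :=
      (B.contMDiff_act_right g).mdifferentiableAt (by simp)
    have hp : MDifferentiableAt 𝓘(ℝ, EP) 𝓘(ℝ, EM) B.proj (B.act u g) :=
      B.contMDiff_proj.mdifferentiableAt (by simp)
    have d := hp.hasMFDerivAt.comp u hg.hasMFDerivAt
    have e : B.proj ∘ (fun u => B.act u g) = B.proj := funext fun u => B.proj_act u g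
    rw [e] at d
    have d' := (B.contMDiff_proj.mdifferentiableAt (x := u) (by simp)).hasMFDerivAt
    have := congrArg (fun L => L (X.1 u)) (hasMFDerivAt_unique d' d)
    refine Eq.trans this ?_
    exact congrArg (mfderiv 𝓘(ℝ, EP) 𝓘(ℝ, EM) B.proj (B.act u g)) (X.2 g u)
  let s : M → P := Function.surjInv B.proj_surjective
  have hs : ∀ m, B.proj (s m) = m := Function.surjInv_eq B.proj_surjective
  let v : ∀ m : M, TangentSpace 𝓘(ℝ, EM) m :=
    fun m => (mfderiv 𝓘(ℝ, EP) 𝓘(ℝ, EM) B.proj (s m) (X.1 (s m)) : EM)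
  have hv : ∀ u, mfderiv 𝓘(ℝ, EP) 𝓘(ℝ, EM) B.proj u (X.1 u) = v (B.proj u) :=
    fun u => hcoh u (s (B.proj u)) (hs _).symm
  refine ⟨⟨v, fun m => ?_⟩, hv⟩
  obtain ⟨e, hm, -, he, -⟩ := B.exists_trivialization m
  let σ : M → P := fun x => e.toOpenPartialHomeomorph.symm (x, 1)
  have hσ : ContMDiffAt 𝓘(ℝ, EM) 𝓘(ℝ, EP) ∞ σ m := by
    have h1 : ContMDiffAt (𝓘(ℝ, EM).prod 𝓘(ℝ, EG)) 𝓘(ℝ, EP) ∞ e.toOpenPartialHomeomorph.symm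
        (m, (1 : G)) := he.contMDiffAt (e.open_target.mem_nhds (by rw [e.mem_target]; exact hm))
    exact h1.comp m (contMDiffAt_id.prodMk contMDiffAt_const)
  have hT : ContMDiff 𝓘(ℝ, EP).tangent 𝓘(ℝ, EM).tangent ∞ (tangentMap 𝓘(ℝ, EP) 𝓘(ℝ, EM) B.proj) :=
    B.contMDiff_proj.contMDiff_tangentMap (by rfl)
  have hX := X.1.contMDiff
  have hc := hT.contMDiffAt.comp m ((hX (σ m)).comp m hσ)
  refine hc.congr_of_eventuallyEq ?_
  filter_upwards [e.open_baseSet.mem_nhds hm] with x hx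
  have hpx : B.proj (σ x) = x := e.proj_symm_apply' hx
  have h2 : (⟨B.proj (σ x), v (B.proj (σ x))⟩ : TangentBundle 𝓘(ℝ, EM) M) = ⟨x, v x⟩ := by rw [hpx]
  refine h2.symm.trans ?_
  exact congrArg (Bundle.TotalSpace.mk' EM (B.proj (σ x))) (hv (σ x)).symm

theorem eq_of_related {X : SmoothVectorField EP P} {v w : SmoothVectorField EM M}
    (hv : X.Related B.proj v) (hw : X.Related B.proj w) : v = w := by
  ext m
  obtain ⟨u, rfl⟩ := B.proj_surjective m
  exact (hv u).symm.trans (hw u)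

/-- The anchor `π_* : 𝒜 → 𝔛(M)`, see `anchor_proj`: `(π_* X)_{π(u)} = T_u π (X_u)`. -/
def anchor : B.atiyahAlgebra →ₗ⁅ℝ⁆ SmoothVectorField EM M where
  toFun X := (B.exists_anchor X).choose
  map_add' X Y := B.eq_of_related (B.exists_anchor (X + Y)).choose_spec fun u =>
    (map_add _ _ _).trans
      (congrArg₂ (· + ·) ((B.exists_anchor X).choose_spec u) ((B.exists_anchor Y).choose_spec u))
  map_smul' c X := B.eq_of_related (B.exists_anchor (c • X)).choose_spec fun u =>
    (map_smul _ c _).trans (congrArg (c • ·) ((B.exists_anchor X).choose_spec u))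
  map_lie' {X Y} := B.eq_of_related (B.exists_anchor ⁅X, Y⁆).choose_spec
    ((B.exists_anchor X).choose_spec.lie B.contMDiff_proj (B.exists_anchor Y).choose_spec)

theorem anchor_proj (X : B.atiyahAlgebra) (u : P) :
    B.anchor X (B.proj u) = mfderiv 𝓘(ℝ, EP) 𝓘(ℝ, EM) B.proj u (X.1 u) :=
  ((B.exists_anchor X).choose_spec u).symm

/-- The kernel `𝒦` of the anchor, as a Lie ideal of `𝒜`. -/
abbrev kernelAlgebra : LieIdeal ℝ B.atiyahAlgebra := B.anchor.ker

/-- The Lie subalgebra `𝒜_m = {a ∈ 𝒜 | (π_* a)_m = 0}` of `𝒜`. -/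
def isotropySubalgebra (m : M) : LieSubalgebra ℝ B.atiyahAlgebra where
  carrier := {a | B.anchor a m = 0}
  zero_mem' := by simp
  add_mem' {a b} ha hb := by
    simp only [mem_ofPred_eq] at ha hb ⊢
    simp [ha, hb]
  smul_mem' c a ha := by
    simp only [mem_ofPred_eq] at ha ⊢
    simp [ha]
  lie_mem' {a b} ha hb := by
    simp only [mem_ofPred_eq] at ha hb ⊢
    rw [LieHom.map_lie, SmoothVectorField.lie_apply, ← mlieBracketWithin_univ]
    exact mlieBracketWithin_eq_zero_of_eq_zero ha hb

/-- The subspace `𝒦(m) = {k ∈ 𝒦 | k_m = 0}` of `𝒦`. Here `k_m ∈ (TP/G)_m` is the class of the vectors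
`k_u`, `π(u) = m`, so it vanishes if and only if all of these do. -/
def kernelVanishingAt (m : M) : Submodule ℝ B.kernelAlgebra where
  carrier := {k | ∀ u : P, B.proj u = m → k.1.1 u = 0}
  zero_mem' u _ := by simp
  add_mem' {k l} hk hl u hu := by
    have h1 := hk u hu
    have h2 := hl u hu
    simp [h1, h2]
  smul_mem' c k hk u hu := by
    have h1 := hk u hu
    simp [h1]

/-- The maximal finite-codimensional Lie ideals `J` of `𝒦` that are normalized by the Lie subalgebra
`T` of `𝒜`, i.e. with `[T, J] ⊆ J`. -/
def normalizedMaximalIdeals (T : LieSubalgebra ℝ B.atiyahAlgebra) :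
    Set (LieIdeal ℝ B.kernelAlgebra) :=
  {J | J.IsMaximalFiniteCodim ∧ T ≤ B.kernelAlgebra.ambientNormalizer J}

end SmoothPrincipalBundle

end AtiyahDefinitions

/-! Write R for C^∞(M). The Leibniz rule `lie_smul_eq` makes 𝒜 a Lie–Rinehart algebra over R, and
the proof is commutative algebra in R. A subspace S of 𝒜 or 𝒦 is studied through its
`multiplierIdeal`, the ideal of the f that multiply the whole module into S. For the subspaces that
matter, this ideal J is coalgebraic: every g satisfies p(g) ∈ J for some nonzero real polynomial p.
Finite codimension forces this, by commutator identities that extract f² (x h)² from f • x and fh •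
x (`isCoalgebraic_multiplierIdeal`). They need finitely many a_i and h_i with ∑ (a_i h_i)² a unit.
Two pairs suffice, since a generic map M → ℝ² has nowhere vanishing differential
(`exists_isUnit_sum_sq`); here the positive dimension of M enters.

Applying this to a proper smooth function shows that a proper coalgebraic ideal of R has a common
zero x (`exists_forall_mem_eq_zero`). Every derivation that preserves the ideal vanishes at x,
because differentiating p(g) lowers the degree of p (`eval_derivation_eq_zero`). A subalgebra T
preserves its own multiplier ideal, so a proper T of finite codimension lies in some 𝒜_x. Together
with the maximality of 𝒜_m this settles the statements about subalgebras.

Let J now be a maximal ideal of 𝒦 normalized by 𝒜_m. Its multiplier ideal is again coalgebraic and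
is preserved by the normalizer of J, so its only zero is m and the normalizer is 𝒜_m
(`ambientNormalizer_eq`). Since 𝔤 is perfect, 𝒦 is locally perfect and J does not contain [𝒦, 𝒦].
Maximality then makes J an R-submodule that contains f • 𝒦 whenever f(m) = 0, and hence contains
𝒦(m) (`kernelVanishingAt_le`).

Conversely, 𝒦/𝒦(m) ≅ 𝔤, on which 𝒜_m acts by derivations. Each ideal I of 𝔤 satisfies I = [I, I] and
is therefore stable under derivations. The maximal ideals of 𝔤 intersect in 0 and pull back to
normalized maximal ideals with intersection 𝒦(m) (`exists_mem_normalizedMaximalIdeals_notMem`). -/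

open Polynomial

/-! ### Subspaces of finite codimension. -/

section FiniteCodimension

variable {V W : Type*} [AddCommGroup V] [Module ℝ V] [AddCommGroup W] [Module ℝ W]

theorem Submodule.CoFG.comap_linearMap {S : Submodule ℝ W} (hS : S.CoFG) (f : V →ₗ[ℝ] W) :
    (S.comap f).CoFG := by
  have : Module.Finite ℝ (W ⧸ S) := hS
  have h := Submodule.CoFG.ker (S.mkQ.comp f)
  rwa [LinearMap.ker_comp, Submodule.ker_mkQ] at h

theorem Submodule.CoFG.map_subtype {S : Submodule ℝ V} (hS : S.CoFG) {S' : Submodule ℝ S}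
    (hS' : S'.CoFG) : (S'.map S.subtype).CoFG := by
  have h1 : Module.Finite ℝ (S ⧸ S') := hS'
  have h2 : Module.Finite ℝ (V ⧸ S) := hS
  let q : V →ₗ[ℝ] V ⧸ S'.map S.subtype := (S'.map S.subtype).mkQ
  have hle : S'.map S.subtype ≤ S := Submodule.map_subtype_le _ _
  let p : (V ⧸ S'.map S.subtype) →ₗ[ℝ] V ⧸ S := Submodule.factor hle
  have hker : LinearMap.ker p ≤ LinearMap.range (q.comp S.subtype) := by
    intro x hx
    obtain ⟨v, rfl⟩ := Submodule.mkQ_surjective _ x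
    have hv : v ∈ S := by
      rw [← Submodule.Quotient.mk_eq_zero]
      exact hx
    exact ⟨⟨v, hv⟩, rfl⟩
  have hfin : (LinearMap.range (q.comp S.subtype)).FG := by
    rw [Submodule.range_fg_iff_ker_cofg]
    refine hS'.of_le fun x hx => ?_
    rw [LinearMap.mem_ker, LinearMap.comp_apply, Submodule.mkQ_apply,
      Submodule.Quotient.mk_eq_zero]
    exact Submodule.mem_map_of_mem hx
  have hk : (LinearMap.ker p).FG := by
    have : Module.Finite ℝ (LinearMap.range (q.comp S.subtype)) := Module.Finite.of_fg hfin
    have := Module.Finite.of_injective (Submodule.inclusion hker) (Submodule.inclusion_injective _)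
    exact Module.Finite.iff_fg.1 this
  have hr : (⊤ : Submodule ℝ (V ⧸ S'.map S.subtype)).FG := by
    refine Submodule.fg_of_fg_map_of_fg_inf_ker p ?_ (by simpa using hk)
    exact IsNoetherian.noetherian _
  exact ⟨hr⟩

/-- If a linear map takes values in the maps `U → F` factoring through a finite-dimensional
quotient of `U`, its kernel has finite codimension. -/
theorem cofg_ker_of_factor {U F : Type*} [AddCommGroup U] [Module ℝ U] [AddCommGroup F]
    [Module ℝ F] [Module.Finite ℝ F] (Q : Submodule ℝ U) (hQ : Q.CoFG) (φ : V →ₗ[ℝ] U →ₗ[ℝ] F)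
    (h : ∀ v, ∀ u ∈ Q, φ v u = 0) : (LinearMap.ker φ).CoFG := by
  have : Module.Finite ℝ (U ⧸ Q) := hQ
  let ψ : V →ₗ[ℝ] (U ⧸ Q) →ₗ[ℝ] F :=
    { toFun := fun v => Q.liftQ (φ v) fun u hu => h v u hu
      map_add' := fun v w => Submodule.linearMap_qext _ (by ext u; simp; rfl)
      map_smul' := fun c v => Submodule.linearMap_qext _ (by ext u; simp; rfl) }
  refine (Submodule.CoFG.ker ψ).of_le fun v hv => ?_
  rw [LinearMap.mem_ker] at hv ⊢
  ext u
  exact congrArg (fun l => l (Submodule.Quotient.mk u)) hv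

end FiniteCodimension

/-! ### Lie–Rinehart algebras and multiplier ideals. -/

section LieRinehart

variable {R L : Type*} [CommRing R] [Algebra ℝ R] [LieRing L] [LieAlgebra ℝ L] [Module R L]
  [IsScalarTower ℝ R L]

/-- The infinite-dimensional space ℝ[X] cannot inject into the finite-dimensional quotient R ⧸ W. -/
theorem exists_aeval_mem_of_cofg {W : Submodule ℝ R} (hW : W.CoFG) (g : R) :
    ∃ p : ℝ[X], p ≠ 0 ∧ aeval g p ∈ W := by
  have : Module.Finite ℝ (R ⧸ W) := hW
  let φ : ℝ[X] →ₗ[ℝ] R ⧸ W := W.mkQ.comp (aeval g).toLinearMap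
  have hφ : ¬ Function.Injective φ := fun h => by
    have := Module.Finite.of_injective φ h
    exact Polynomial.not_finite this
  rw [← LinearMap.ker_eq_bot, Submodule.eq_bot_iff] at hφ
  push Not at hφ
  obtain ⟨p, hp, h0⟩ := hφ
  refine ⟨p, h0, ?_⟩
  rw [← Submodule.Quotient.mk_eq_zero]
  exact hp

/-- An ideal `J` such that `R ⧸ J` is algebraic over `ℝ`. -/
def Ideal.IsCoalgebraic (J : Ideal R) : Prop :=
  ∀ g : R, ∃ p : ℝ[X], p ≠ 0 ∧ aeval g p ∈ J

theorem Ideal.IsCoalgebraic.mono {I J : Ideal R} (hI : I.IsCoalgebraic) (h : I ≤ J) :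
    J.IsCoalgebraic := fun g => (hI g).imp fun _ hp => ⟨hp.1, h hp.2⟩

/-- The ideal of those `f : R` with `f • x ∈ S` for all `x`. -/
def multiplierIdeal (R : Type*) {L : Type*} [CommRing R] [Algebra ℝ R] [AddCommGroup L]
    [Module ℝ L] [Module R L] (S : Submodule ℝ L) : Ideal R where
  carrier := {f | ∀ x : L, f • x ∈ S}
  zero_mem' x := by simp
  add_mem' hf hg x := by rw [add_smul]; exact S.add_mem (hf x) (hg x)
  smul_mem' g f hf x := by
    rw [smul_eq_mul, mul_comm, mul_smul]
    exact hf _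

theorem mem_multiplierIdeal {R L : Type*} [CommRing R] [Algebra ℝ R] [AddCommGroup L]
    [Module ℝ L] [Module R L] {S : Submodule ℝ L} {f : R} :
    f ∈ multiplierIdeal R S ↔ ∀ x : L, f • x ∈ S := Iff.rfl

/-- The Lie subalgebra `{x ∈ T | [x, L] ⊆ T}` of a Lie subalgebra `T` of `L`. -/
def LieSubalgebra.idealCore (T : LieSubalgebra ℝ L) : LieSubalgebra ℝ L where
  carrier := {x | x ∈ T ∧ ∀ y, ⁅x, y⁆ ∈ T}
  zero_mem' := ⟨T.zero_mem, by simp⟩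
  add_mem' hx hy := ⟨T.add_mem hx.1 hy.1, fun z => by
    rw [add_lie]; exact T.add_mem (hx.2 z) (hy.2 z)⟩
  smul_mem' c x hx := ⟨T.smul_mem c hx.1, fun z => by
    rw [smul_lie]; exact T.smul_mem c (hx.2 z)⟩
  lie_mem' {x y} hx hy := ⟨hx.2 y, fun z => by
    rw [lie_lie]; exact T.sub_mem (hx.2 _) (hy.2 _)⟩

/-- The core is the kernel of the action of T on the finite-dimensional space L ⧸ T. -/
theorem LieSubalgebra.cofg_idealCore {T : LieSubalgebra ℝ L} (hT : T.toSubmodule.CoFG) :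
    T.idealCore.toSubmodule.CoFG := by
  have : Module.Finite ℝ (L ⧸ T.toSubmodule) := hT
  let φ : T.toSubmodule →ₗ[ℝ] L →ₗ[ℝ] L ⧸ T.toSubmodule :=
    (LinearMap.compRight ℝ T.toSubmodule.mkQ).comp
      ((LieModule.toEnd ℝ L L : L →ₗ[ℝ] Module.End ℝ L).comp T.toSubmodule.subtype)
  have h := cofg_ker_of_factor T.toSubmodule hT φ fun v u hu => by
    simp only [φ, LinearMap.comp_apply, LinearMap.compRight_apply, Submodule.mkQ_apply,
      Submodule.Quotient.mk_eq_zero]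
    exact T.lie_mem v.2 hu
  refine (hT.map_subtype h).of_le ?_
  rintro _ ⟨x, hx, rfl⟩
  refine ⟨x.2, fun y => ?_⟩
  have := congrArg (fun l => l y) (LinearMap.mem_ker.1 hx)
  simpa [φ, LinearMap.comp_apply, Submodule.Quotient.mk_eq_zero] using this

variable (D : L →ₗ[R] Derivation ℝ R R)

theorem smul_lie_of_lie_smul (hD : ∀ (x : L) (f : R) (y : L), ⁅x, f • y⁆ = f • ⁅x, y⁆ + D x f • y)
    (f : R) (x y : L) : ⁅f • x, y⁆ = f • ⁅x, y⁆ - D y f • x := by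
  rw [← lie_skew, hD, ← lie_skew x y, smul_neg]; abel

/-- Two polarizations, each using up one passage to the core. With u = f² x(h), the difference [f x,
fhr x] − [fh x, fr x] equals 2ur x, so u r x lies in the first core for every r. Next, [u x, h y] −
[uh x, y] = u x(h) y + u y(h) x, and the last term is already in T; what remains is f² x(h)² y. -/
theorem sq_mul_sq_mem_multiplierIdeal
    (hD : ∀ (x : L) (f : R) (y : L), ⁅x, f • y⁆ = f • ⁅x, y⁆ + D x f • y)
    {T : LieSubalgebra ℝ L} {f h : R} {x : L} (hf : f • x ∈ T.idealCore.idealCore)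
    (hfh : (f * h) • x ∈ T.idealCore.idealCore) :
    f ^ 2 * D x h ^ 2 ∈ multiplierIdeal R T.toSubmodule := by
  have hl := smul_lie_of_lie_smul D hD
  set u : R := f ^ 2 * D x h with hu
  have h1 : ∀ r : R, (u * r) • x ∈ T.idealCore := by
    intro r
    have e1 := hf.2 ((f * h * r) • x)
    have e2 := hfh.2 ((f * r) • x)
    have e3 := T.idealCore.sub_mem e1 e2
    have e4 : ⁅f • x, (f * h * r) • x⁆ - ⁅(f * h) • x, (f * r) • x⁆ = (2 : ℝ) • ((u * r) • x) := by
      simp only [hD, hl, map_smul, Derivation.leibniz, lie_self, smul_zero, smul_smul, zero_add,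
        Derivation.smul_apply, smul_eq_mul, sub_eq_add_neg, ← neg_smul, ← add_smul]
      rw [two_smul, ← add_smul]
      congr 1
      rw [hu]; ring
    rw [e4] at e3
    have := T.idealCore.smul_mem (2⁻¹ : ℝ) e3
    rwa [smul_smul, inv_mul_cancel₀ (by norm_num), one_smul] at this
  intro y
  have e1 := (h1 h).2 y
  have e2 := (h1 1).2 (h • y)
  have e3 := T.sub_mem e2 e1
  have e4 := T.add_mem e3 ((h1 (-(D y h))).1)
  have e5 : ⁅(u * 1) • x, h • y⁆ - ⁅(u * h) • x, y⁆ + (u * -(D y h)) • x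
      = (f ^ 2 * D x h ^ 2) • y := by
    simp only [hD, hl, map_smul, Derivation.leibniz, smul_smul, mul_one, smul_sub,
      Derivation.smul_apply, smul_eq_mul]
    have : (f ^ 2 * D x h ^ 2) = u * D x h := by rw [hu]; ring
    rw [this, mul_comm u h, mul_neg, neg_smul, add_smul]
    abel
  rw [e5] at e4
  exact e4

/-- For each i, the f with f • x_i and (f h_i) • x_i in the double core form a subspace of finite
codimension, so it contains a polynomial p_i(g). The product of all p_i(g)², multiplied by the unit
∑ (x_i h_i)², then lies in the ideal. -/
theorem isCoalgebraic_multiplierIdeal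
    (hD : ∀ (x : L) (f : R) (y : L), ⁅x, f • y⁆ = f • ⁅x, y⁆ + D x f • y)
    {T : LieSubalgebra ℝ L} (hT : T.toSubmodule.CoFG) {ι : Type*} [Fintype ι] (x : ι → L)
    (h : ι → R) (hu : IsUnit (∑ i, D (x i) (h i) ^ 2)) :
    (multiplierIdeal R T.toSubmodule).IsCoalgebraic := by
  classical
  intro g
  have hV := LieSubalgebra.cofg_idealCore (LieSubalgebra.cofg_idealCore hT)
  set V := T.idealCore.idealCore.toSubmodule
  have key : ∀ i, ∃ p : ℝ[X], p ≠ 0 ∧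
      aeval g p ^ 2 * D (x i) (h i) ^ 2 ∈ multiplierIdeal R T.toSubmodule := by
    intro i
    let a : R →ₗ[ℝ] L := (LinearMap.toSpanSingleton R L (x i)).restrictScalars ℝ
    have h1 := hV.comap_linearMap a
    have h2 := hV.comap_linearMap (a.comp (LinearMap.mulRight ℝ (h i)))
    obtain ⟨p, hp, hp'⟩ := exists_aeval_mem_of_cofg (h1.inf h2) g
    refine ⟨p, hp, sq_mul_sq_mem_multiplierIdeal D hD ?_ ?_⟩
    · exact hp'.1
    · exact hp'.2
  choose p hp hp' using key
  refine ⟨∏ i, p i ^ 2, Finset.prod_ne_zero_iff.2 fun i _ => pow_ne_zero _ (hp i), ?_⟩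
  rw [← Ideal.mul_unit_mem_iff_mem _ hu, Finset.mul_sum]
  refine Ideal.sum_mem _ fun i _ => ?_
  rw [map_prod, ← Finset.mul_prod_erase _ _ (Finset.mem_univ i), mul_right_comm, map_pow]
  exact Ideal.mul_mem_right _ _ (hp' i)

/-- Suppose ev(d g) ≠ 0. If s p(g) ∈ J with ev s ≠ 0, applying d gives s² d(g) p'(g) ∈ J, and s²
d(g) again has nonzero value. The degree of p drops until a nonzero constant times such an s lies in
J, contradicting that ev vanishes on J. The factor s is carried along to absorb d(g) at each
differentiation. -/
theorem eval_derivation_eq_zero {J : Ideal R} (hJ : J.IsCoalgebraic) (d : Derivation ℝ R R)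
    (hd : ∀ f ∈ J, d f ∈ J) (ev : R →ₐ[ℝ] ℝ) (hev : ∀ f ∈ J, ev f = 0) (g : R) :
    ev (d g) = 0 := by
  by_contra hg
  have key : ∀ n : ℕ, ∀ p : ℝ[X], p ≠ 0 → p.natDegree ≤ n →
      ∀ s : R, ev s ≠ 0 → s * aeval g p ∉ J := by
    intro n
    induction n with
    | zero =>
      intro p hp hn s hs hm
      rw [Polynomial.eq_C_of_natDegree_le_zero hn] at hm hp
      have h := hev _ hm
      simp only [aeval_C, map_mul, AlgHom.commutes] at h
      exact mul_ne_zero hs (fun h0 => hp (by simpa using h0)) h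
    | succ n ih =>
      intro p hp hn s hs hm
      by_cases h0 : p.natDegree = 0
      · exact ih p hp (by omega) s hs hm
      have hp' : derivative p ≠ 0 := fun h =>
        h0 (Polynomial.derivative_eq_zero.1 h)
      have hn' : (derivative p).natDegree ≤ n := by
        have := Polynomial.natDegree_derivative_lt h0
        omega
      refine ih _ hp' hn' (s ^ 2 * d g) (by simpa [hs] using hg) ?_
      have e : s ^ 2 * d g * aeval g (derivative p)
          = s * d (s * aeval g p) - d s * (s * aeval g p) := by
        rw [Derivation.leibniz, Derivation.map_aeval]
        simp only [smul_eq_mul]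
        ring
      rw [e]
      exact J.sub_mem (J.mul_mem_left _ (hd _ hm)) (J.mul_mem_left _ hm)
  obtain ⟨p, hp, hm⟩ := hJ g
  exact key _ p hp le_rfl 1 (by simp) (by simpa using hm)

theorem derivation_mem_multiplierIdeal
    (hD : ∀ (x : L) (f : R) (y : L), ⁅x, f • y⁆ = f • ⁅x, y⁆ + D x f • y)
    {T : LieSubalgebra ℝ L} {x : L} (hx : x ∈ T) {f : R}
    (hf : f ∈ multiplierIdeal R T.toSubmodule) : D x f ∈ multiplierIdeal R T.toSubmodule := by
  intro y
  have h := T.sub_mem (T.lie_mem hx (hf y)) (hf ⁅x, y⁆)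
  rwa [hD, add_sub_cancel_left] at h

/-! ### Multiplier ideals of ideals of the kernel. -/

section KernelIdeal

variable {K : LieIdeal ℝ L} [Module R K] (hK : ∀ (f : R) (k : K), ((f • k : K) : L) = f • (k : L))

/-- The Lie subalgebra of those elements of the normalizer of `J` that act trivially on `K ⧸ J`. -/
def LieIdeal.trivialActor (K : LieIdeal ℝ L) (J : LieIdeal ℝ K) : LieSubalgebra ℝ L where
  carrier := {a | ∀ k : K, ⁅a, k⁆ ∈ J}
  zero_mem' k := by simp
  add_mem' ha hb k := by rw [add_lie]; exact add_mem (ha k) (hb k)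
  smul_mem' c a ha k := by rw [smul_lie]; exact J.smul_mem c (ha k)
  lie_mem' {a b} ha hb k := by rw [lie_lie]; exact sub_mem (ha _) (hb _)

theorem LieIdeal.mem_ambientNormalizer_iff (J : LieIdeal ℝ K) (a : L) :
    a ∈ K.ambientNormalizer J ↔ ∀ k ∈ J, ⁅a, k⁆ ∈ J := by
  rw [LieIdeal.mem_ambientNormalizer]
  refine forall₂_congr fun k _ => ⟨?_, fun h => ⟨_, h, rfl⟩⟩
  rintro ⟨k', hk', e⟩
  have : k' = ⁅a, k⁆ := Subtype.ext e
  rwa [← this]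

theorem LieIdeal.cofg_trivialActor {J : LieIdeal ℝ K} (hJ : J.toSubmodule.CoFG)
    {T : LieSubalgebra ℝ L} (hT : T.toSubmodule.CoFG) (hTJ : T ≤ K.ambientNormalizer J) :
    (K.trivialActor J).toSubmodule.CoFG := by
  have : Module.Finite ℝ (K ⧸ J.toSubmodule) := hJ
  let φ : T.toSubmodule →ₗ[ℝ] K →ₗ[ℝ] K ⧸ J.toSubmodule :=
    (LinearMap.compRight ℝ J.toSubmodule.mkQ).comp
      ((LieModule.toEnd ℝ L K : L →ₗ[ℝ] Module.End ℝ K).comp T.toSubmodule.subtype)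
  have h := cofg_ker_of_factor J.toSubmodule hJ φ fun v u hu => by
    simp only [φ, LinearMap.comp_apply, LinearMap.compRight_apply, Submodule.mkQ_apply,
      Submodule.Quotient.mk_eq_zero]
    exact (K.mem_ambientNormalizer_iff J v).1 (hTJ v.2) u hu
  refine (hT.map_subtype h).of_le ?_
  rintro _ ⟨x, hx, rfl⟩
  intro y
  have := congrArg (fun l => l y) (LinearMap.mem_ker.1 hx)
  simpa [φ, LinearMap.comp_apply, Submodule.Quotient.mk_eq_zero] using this

include hK in
-- The elements acting trivially on K ⧸ J form a subalgebra of finite codimension, so its multiplier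
-- ideal is coalgebraic. If f lies in that ideal, then [f x, h k] − [fh x, k] = f x(h) k lies in J,
-- because k acts as zero on functions. Thus f times the unit ∑ (x_i h_i)² multiplies K into J.
theorem isCoalgebraic_multiplierIdeal_lieIdeal
    (hD : ∀ (x : L) (f : R) (y : L), ⁅x, f • y⁆ = f • ⁅x, y⁆ + D x f • y)
    (hDK : ∀ k ∈ K, D k = 0) {J : LieIdeal ℝ K} (hJ : J.toSubmodule.CoFG)
    {T : LieSubalgebra ℝ L} (hT : T.toSubmodule.CoFG) (hTJ : T ≤ K.ambientNormalizer J)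
    {ι : Type*} [Fintype ι] (x : ι → L) (h : ι → R) (hu : IsUnit (∑ i, D (x i) (h i) ^ 2)) :
    (multiplierIdeal R J.toSubmodule).IsCoalgebraic := by
  refine (isCoalgebraic_multiplierIdeal D hD (LieIdeal.cofg_trivialActor hJ hT hTJ) x h hu).mono ?_
  intro f hf
  rw [← Ideal.mul_unit_mem_iff_mem _ hu, Finset.mul_sum]
  refine Ideal.sum_mem _ fun i _ => ?_
  rw [pow_two, ← mul_assoc]
  refine Ideal.mul_mem_right _ _ fun k => ?_
  have h1 : ⁅f • x i, h i • k⁆ ∈ J := hf (x i) (h i • k)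
  have h2 : ⁅f • h i • x i, k⁆ ∈ J := hf (h i • x i) k
  have h3 := sub_mem h1 h2
  have e : ⁅f • x i, h i • k⁆ - ⁅f • h i • x i, k⁆ = (f * D (x i) (h i)) • k := by
    apply Subtype.ext
    rw [hK, LieSubmodule.coe_sub, LieSubmodule.coe_bracket, LieSubmodule.coe_bracket, hK, hD,
      smul_smul, mul_comm f (h i), mul_smul, smul_lie_of_lie_smul D hD (h i), hDK k k.2]
    simp
  rw [e] at h3
  exact h3

include hK in
theorem derivation_mem_multiplierIdeal_lieIdeal
    (hD : ∀ (x : L) (f : R) (y : L), ⁅x, f • y⁆ = f • ⁅x, y⁆ + D x f • y)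
    {J : LieIdeal ℝ K} {x : L} (hx : x ∈ K.ambientNormalizer J) {f : R}
    (hf : f ∈ multiplierIdeal R J.toSubmodule) : D x f ∈ multiplierIdeal R J.toSubmodule := by
  intro k
  have h1 := (K.mem_ambientNormalizer_iff J x).1 hx _ (hf k)
  have h := sub_mem h1 (hf ⁅x, k⁆)
  have e : ⁅x, f • k⁆ - f • ⁅x, k⁆ = D x f • k := by
    apply Subtype.ext
    rw [LieSubmodule.coe_sub, LieSubmodule.coe_bracket, hK, hK, hK, hD, LieSubmodule.coe_bracket,
      add_sub_cancel_left]
  rw [e] at h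
  exact h

end KernelIdeal

end LieRinehart

/-! ### Maximal ideals of a Lie algebra with R-linear bracket. -/

section MaximalIdeal

variable {R K : Type*} [CommRing R] [Algebra ℝ R] [LieRing K] [LieAlgebra ℝ K] [Module R K]
  [IsScalarTower ℝ R K] (hR : ∀ (f : R) (x y : K), ⁅x, f • y⁆ = f • ⁅x, y⁆)

theorem LieIdeal.IsMaximalFiniteCodim.eq_or_eq_top {J J' : LieIdeal ℝ K}
    (hJ : J.IsMaximalFiniteCodim) (h : J ≤ J') : J' = J ∨ J' = ⊤ := by
  by_contra! hne
  refine hJ.2.2 J' hne.2 (Submodule.CoFG.of_le (S := J.toSubmodule) h hJ.2.1)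
    (lt_of_le_of_ne h hne.1.symm)

include hR in
-- The ideal C = {x | [K, x] ⊆ J} contains J and is proper since [K, K] is not inside J, so C = J by
-- maximality. For x ∈ J, [y, f x] = f [y, x] = [f y, x] ∈ J, which means f x ∈ C.
theorem LieIdeal.IsMaximalFiniteCodim.smul_mem_of_mem {J : LieIdeal ℝ K}
    (hJ : J.IsMaximalFiniteCodim) (hperf : ∃ x y : K, ⁅x, y⁆ ∉ J) (f : R) {x : K} (hx : x ∈ J) :
    f • x ∈ J := by
  let C : LieIdeal ℝ K :=
    { carrier := {x | ∀ y : K, ⁅y, x⁆ ∈ J}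
      zero_mem' := fun y => by simp
      add_mem' := fun ha hb y => by rw [lie_add]; exact add_mem (ha y) (hb y)
      smul_mem' := fun c x hx y => by rw [lie_smul]; exact J.smul_mem c (hx y)
      lie_mem := fun {a x} hx y => by
        rw [leibniz_lie y a x]
        exact add_mem (hx _) (J.lie_mem (hx _)) }
  have hC : J ≤ C := fun x hx y => J.lie_mem hx
  have hCt : C ≠ ⊤ := by
    obtain ⟨x, y, hxy⟩ := hperf
    intro h
    exact hxy ((h ▸ LieSubmodule.mem_top y : y ∈ C) x)
  have hCJ := (hJ.eq_or_eq_top hC).resolve_right hCt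
  rw [← hCJ]
  intro y
  rw [hR, ← lie_skew, smul_neg, ← hR]
  exact neg_mem (lie_mem_left ℝ K J _ _ hx)

include hR in
-- By maximality the ideal J + fK is J or K. If it were K, iterating would give K = J + fⁿK = J, as
-- in Nakayama's lemma.
theorem LieIdeal.IsMaximalFiniteCodim.smul_mem_of_pow {J : LieIdeal ℝ K}
    (hJ : J.IsMaximalFiniteCodim) (hJR : ∀ (f : R), ∀ x ∈ J, f • x ∈ J) (f : R) (n : ℕ)
    (hn : ∀ x : K, f ^ n • x ∈ J) (x : K) : f • x ∈ J := by
  let F : LieIdeal ℝ K :=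
    { carrier := {x | ∃ j ∈ J, ∃ y, x = j + f • y}
      zero_mem' := ⟨0, J.zero_mem, 0, by simp⟩
      add_mem' := by
        rintro _ _ ⟨j, hj, y, rfl⟩ ⟨j', hj', y', rfl⟩
        exact ⟨j + j', add_mem hj hj', y + y', by rw [smul_add]; abel⟩
      smul_mem' := by
        rintro c _ ⟨j, hj, y, rfl⟩
        refine ⟨c • j, J.smul_mem c hj, c • y, ?_⟩
        rw [smul_add, ← algebraMap_smul R c (f • y), ← algebraMap_smul R c y, smul_smul, smul_smul,
          mul_comm]
      lie_mem := by
        rintro a _ ⟨j, hj, y, rfl⟩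
        exact ⟨⁅a, j⁆, J.lie_mem hj, ⁅a, y⁆, by rw [lie_add, hR]⟩ }
  have hF : J ≤ F := fun j hj => ⟨j, hj, 0, by simp⟩
  rcases hJ.eq_or_eq_top hF with h | h
  · rw [← h]
    exact ⟨0, J.zero_mem, x, by simp⟩
  · exfalso
    have key : ∀ m : ℕ, ∀ z : K, ∃ j ∈ J, ∃ y, z = j + f ^ m • y := by
      intro m
      induction m with
      | zero => exact fun z => ⟨0, J.zero_mem, z, by simp⟩
      | succ m ih =>
        intro z
        obtain ⟨j, hj, y, rfl⟩ := ih z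
        obtain ⟨j', hj', y', rfl⟩ := (h ▸ LieSubmodule.mem_top y : y ∈ F)
        exact ⟨j + f ^ m • j', add_mem hj (hJR _ _ hj'), y', by
          rw [smul_add, smul_smul, pow_succ]; abel⟩
    apply hJ.1
    rw [eq_top_iff]
    intro z _
    obtain ⟨j, hj, y, rfl⟩ := key n z
    exact add_mem hj (hn y)

end MaximalIdeal

/-! ### Vector fields as derivations of the smooth functions. -/

section SmoothDerivative

variable {E : Type*} [NormedAddCommGroup E] [NormedSpace ℝ E]
  {M : Type*} [TopologicalSpace M] [ChartedSpace E M] [IsManifold 𝓘(ℝ, E) ∞ M]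

theorem SmoothVectorField.contMDiff_mvfderiv_apply {F : Type*} [NormedAddCommGroup F]
    [NormedSpace ℝ F] {f : M → F} (hf : ContMDiff 𝓘(ℝ, E) 𝓘(ℝ, F) ∞ f) (v : SmoothVectorField E M) :
    ContMDiff 𝓘(ℝ, E) 𝓘(ℝ, F) ∞ fun m => mvfderiv 𝓘(ℝ, E) f m (v m) := by
  have h1 : ContMDiff 𝓘(ℝ, E).tangent 𝓘(ℝ, F).tangent ∞ (tangentMap 𝓘(ℝ, E) 𝓘(ℝ, F) f) :=
    hf.contMDiff_tangentMap (by rfl)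
  exact (contMDiff_snd_tangentBundle_modelSpace F 𝓘(ℝ, F)).comp (h1.comp v.contMDiff)

/-- The derivation of `C^∞(M)` given by a vector field. -/
noncomputable def SmoothVectorField.derivation (v : SmoothVectorField E M) :
    Derivation ℝ C^∞⟮𝓘(ℝ, E), M; ℝ⟯ C^∞⟮𝓘(ℝ, E), M; ℝ⟯ :=
  Derivation.mk'
    { toFun := fun f => ⟨fun m => mvfderiv 𝓘(ℝ, E) f m (v m), v.contMDiff_mvfderiv_apply f.contMDiff⟩
      map_add' := fun f g => by
        ext m
        have := mvfderiv_add (I := 𝓘(ℝ, E)) (x := m) (f.mdifferentiable m)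
          (g.mdifferentiable m)
        exact congrArg (fun l => l (v m)) this
      map_smul' := fun c f => by
        ext m
        have := mvfderiv_smul (I := 𝓘(ℝ, E)) (x := m) (mdifferentiableAt_const (c := c))
          (f.mdifferentiable m)
        rw [mvfderiv_const] at this
        refine (congrArg (fun l => l (v m)) this).trans ?_
        change c * _ + 0 * _ = c * _
        rw [zero_mul, add_zero]
        rfl }
    fun f g => by
      ext m
      have := mvfderiv_mul (I := 𝓘(ℝ, E)) (x := m) (f.mdifferentiable m)
          (g.mdifferentiable m)
      exact congrArg (fun l => l (v m)) this

end SmoothDerivative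

/-! ### The Atiyah algebra as a Lie–Rinehart algebra over C^∞(M). -/

namespace SmoothPrincipalBundle

variable {EM EG EP : Type*} [NormedAddCommGroup EM] [NormedSpace ℝ EM] [FiniteDimensional ℝ EM]
  [NormedAddCommGroup EG] [NormedSpace ℝ EG]
  [NormedAddCommGroup EP] [NormedSpace ℝ EP] [FiniteDimensional ℝ EP]
  {M G P : Type*} [TopologicalSpace M] [ChartedSpace EM M] [IsManifold 𝓘(ℝ, EM) ∞ M]
  [TopologicalSpace G] [ChartedSpace EG G] [Group G]
  [TopologicalSpace P] [ChartedSpace EP P] [IsManifold 𝓘(ℝ, EP) ∞ P]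
  (B : SmoothPrincipalBundle EM EG EP M G P)

noncomputable instance : SMul C^∞⟮𝓘(ℝ, EM), M; ℝ⟯ B.atiyahAlgebra where
  smul f X := ⟨⟨fun u => f (B.proj u) • X.1 u,
      (f.contMDiff.comp B.contMDiff_proj).smul_section X.1.contMDiff⟩, fun g u => by
    have h := X.2 g u
    refine (map_smul _ _ _).trans ?_
    refine (congrArg (f (B.proj u) • ·) h).trans ?_
    change f (B.proj u) • X.1 (B.act u g) = f (B.proj (B.act u g)) • X.1 (B.act u g)
    rw [B.proj_act]⟩

theorem smul_apply (f : C^∞⟮𝓘(ℝ, EM), M; ℝ⟯) (X : B.atiyahAlgebra) (u : P) :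
    (f • X).1 u = f (B.proj u) • X.1 u := rfl

theorem atiyah_ext {X Y : B.atiyahAlgebra} (h : ∀ u, X.1 u = Y.1 u) : X = Y :=
  Subtype.ext (ContMDiffSection.ext h)

noncomputable instance : Module C^∞⟮𝓘(ℝ, EM), M; ℝ⟯ B.atiyahAlgebra where
  one_smul _ := B.atiyah_ext fun _ => one_smul ℝ _
  mul_smul f _ _ := B.atiyah_ext fun _ => mul_smul (f _) _ _
  smul_zero f := B.atiyah_ext fun u => smul_zero (f (B.proj u))
  smul_add f _ _ := B.atiyah_ext fun u => smul_add (f (B.proj u)) _ _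
  add_smul f _ _ := B.atiyah_ext fun u => add_smul (f (B.proj u)) _ _
  zero_smul _ := B.atiyah_ext fun _ => zero_smul ℝ _

instance : IsScalarTower ℝ C^∞⟮𝓘(ℝ, EM), M; ℝ⟯ B.atiyahAlgebra where
  smul_assoc c f X := B.atiyah_ext fun u => smul_assoc c (f (B.proj u)) (X.1 u)

theorem anchor_smul (f : C^∞⟮𝓘(ℝ, EM), M; ℝ⟯) (X : B.atiyahAlgebra) (m : M) :
    B.anchor (f • X) m = f m • B.anchor X m := by
  obtain ⟨u, rfl⟩ := B.proj_surjective m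
  rw [B.anchor_proj, B.anchor_proj]
  exact map_smul _ _ _

/-- The action of the Atiyah algebra on functions, through the anchor. -/
noncomputable def anchorDerivation : B.atiyahAlgebra →ₗ[C^∞⟮𝓘(ℝ, EM), M; ℝ⟯]
    Derivation ℝ C^∞⟮𝓘(ℝ, EM), M; ℝ⟯ C^∞⟮𝓘(ℝ, EM), M; ℝ⟯ where
  toFun X := (B.anchor X).derivation
  map_add' X Y := by
    ext f m
    rw [map_add]
    exact map_add (mvfderiv 𝓘(ℝ, EM) f m) _ _
  map_smul' f X := by
    ext g m
    refine (congrArg (mvfderiv 𝓘(ℝ, EM) g m) (B.anchor_smul f X m)).trans ?_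
    exact map_smul (mvfderiv 𝓘(ℝ, EM) g m) _ _

theorem anchorDerivation_apply (X : B.atiyahAlgebra) (f : C^∞⟮𝓘(ℝ, EM), M; ℝ⟯) (m : M) :
    B.anchorDerivation X f m = mvfderiv 𝓘(ℝ, EM) f m (B.anchor X m) := rfl

theorem lie_smul_eq (X : B.atiyahAlgebra) (f : C^∞⟮𝓘(ℝ, EM), M; ℝ⟯) (Y : B.atiyahAlgebra) :
    ⁅X, f • Y⁆ = f • ⁅X, Y⁆ + B.anchorDerivation X f • Y := by
  refine B.atiyah_ext fun u => ?_
  have hfp : MDifferentiableAt 𝓘(ℝ, EP) 𝓘(ℝ, ℝ) (f ∘ B.proj) u :=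
    (f.contMDiff.comp B.contMDiff_proj).mdifferentiableAt (by simp)
  have h := VectorField.mlieBracket_smul_right (V := X.1) hfp (Y.1.mdifferentiableAt (x := u))
  have e : mvfderiv 𝓘(ℝ, EP) (f ∘ B.proj) u (X.1 u) = B.anchorDerivation X f (B.proj u) := by
    rw [anchorDerivation_apply, anchor_proj]
    have := mfderiv_comp (I := 𝓘(ℝ, EP)) (I' := 𝓘(ℝ, EM)) (I'' := 𝓘(ℝ, ℝ)) u
      (f.contMDiff.mdifferentiableAt (by simp)) (B.contMDiff_proj.mdifferentiableAt (by simp))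
    exact congrArg (fun l => l (X.1 u)) this
  refine Eq.trans h ?_
  rw [e, add_comm]
  rfl

theorem anchorDerivation_eq_zero {X : B.atiyahAlgebra} (hX : X ∈ B.kernelAlgebra) :
    B.anchorDerivation X = 0 := by
  ext f m
  rw [anchorDerivation_apply, (B.anchor.mem_ker).1 hX]
  exact map_zero (mvfderiv 𝓘(ℝ, EM) f m)

theorem smul_mem_kernelAlgebra (f : C^∞⟮𝓘(ℝ, EM), M; ℝ⟯) {X : B.atiyahAlgebra}
    (hX : X ∈ B.kernelAlgebra) : f • X ∈ B.kernelAlgebra := by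
  rw [LieHom.mem_ker] at hX ⊢
  ext m
  rw [anchor_smul, hX]
  exact smul_zero _

noncomputable instance : SMul C^∞⟮𝓘(ℝ, EM), M; ℝ⟯ B.kernelAlgebra where
  smul f k := ⟨f • k.1, B.smul_mem_kernelAlgebra f k.2⟩

theorem coe_smul_kernel (f : C^∞⟮𝓘(ℝ, EM), M; ℝ⟯) (k : B.kernelAlgebra) :
    ((f • k : B.kernelAlgebra) : B.atiyahAlgebra) = f • (k : B.atiyahAlgebra) := rfl

noncomputable instance : Module C^∞⟮𝓘(ℝ, EM), M; ℝ⟯ B.kernelAlgebra where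
  one_smul _ := Subtype.ext (one_smul _ _)
  mul_smul _ _ _ := Subtype.ext (mul_smul _ _ _)
  smul_zero _ := Subtype.ext (smul_zero _)
  smul_add _ _ _ := Subtype.ext (smul_add _ _ _)
  add_smul _ _ _ := Subtype.ext (add_smul _ _ _)
  zero_smul _ := Subtype.ext (zero_smul _ _)

instance : IsScalarTower ℝ C^∞⟮𝓘(ℝ, EM), M; ℝ⟯ B.kernelAlgebra where
  smul_assoc _ _ _ := Subtype.ext (smul_assoc _ _ _)

theorem lie_smul_kernel (f : C^∞⟮𝓘(ℝ, EM), M; ℝ⟯) (k l : B.kernelAlgebra) :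
    ⁅k, f • l⁆ = f • ⁅k, l⁆ := by
  apply Subtype.ext
  change ⁅k.1, f • l.1⁆ = f • ⁅k.1, l.1⁆
  rw [lie_smul_eq, B.anchorDerivation_eq_zero k.2]
  simp

end SmoothPrincipalBundle

/-! ### Coalgebraic ideals of smooth functions and their zeros. -/

section SmoothFunctions

variable {E : Type*} [NormedAddCommGroup E] [NormedSpace ℝ E]
  {M : Type*} [TopologicalSpace M] [ChartedSpace E M]

/-- Evaluation of smooth functions at a point. -/
noncomputable def evalSmooth (x : M) : C^∞⟮𝓘(ℝ, E), M; ℝ⟯ →ₐ[ℝ] ℝ :=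
  (Pi.evalAlgHom ℝ (fun _ : M => ℝ) x).comp ContMDiffMap.coeFnAlgHom

theorem evalSmooth_apply (x : M) (f : C^∞⟮𝓘(ℝ, E), M; ℝ⟯) : evalSmooth x f = f x := rfl

theorem aeval_smooth_apply (p : ℝ[X]) (f : C^∞⟮𝓘(ℝ, E), M; ℝ⟯) (x : M) :
    aeval f p x = p.eval (f x) := by
  rw [← evalSmooth_apply, ← Polynomial.aeval_algHom_apply, evalSmooth_apply]
  rfl

theorem isUnit_smooth_of_ne_zero {f : C^∞⟮𝓘(ℝ, E), M; ℝ⟯} (hf : ∀ x, f x ≠ 0) : IsUnit f := by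
  refine IsUnit.of_mul_eq_one ⟨fun x => (f x)⁻¹, f.contMDiff.inv₀ hf⟩ ?_
  ext x
  exact mul_inv_cancel₀ (hf x)

theorem exists_proper_smooth [FiniteDimensional ℝ E] [IsManifold 𝓘(ℝ, E) ∞ M] [T2Space M]
    [SigmaCompactSpace M] :
    ∃ ρ : C^∞⟮𝓘(ℝ, E), M; ℝ⟯, ∀ c : ℝ, IsCompact {x | ρ x ≤ c} := by
  have : LocallyCompactSpace M := ChartedSpace.locallyCompactSpace E M
  let K : CompactExhaustion M := default
  -- The index at which a compact exhaustion reaches a point grows by at most one near that point,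
  -- so locally constant majorants exist and can be glued.
  obtain ⟨ρ, hρ⟩ := exists_contMDiffMap_forall_mem_convex_of_local_const (n := ⊤) 𝓘(ℝ, E)
    (t := fun x => Set.Ici (K.find x : ℝ)) (fun x => convex_Ici _) fun x => by
      refine ⟨K.find x + 1, ?_⟩
      have h := mem_interior_iff_mem_nhds.1 (K.subset_interior_succ (K.find x) (K.mem_find x))
      filter_upwards [h] with y hy
      change (K.find y : ℝ) ≤ (K.find x + 1 : ℝ)
      exact_mod_cast K.mem_iff_find_le.1 hy
  refine ⟨ρ, fun c => ?_⟩
  refine (K.isCompact ⌈c⌉₊).of_isClosed_subset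
    (isClosed_le ρ.contMDiff.continuous continuous_const) fun x hx => ?_
  rw [K.mem_iff_find_le]
  have h1 : (K.find x : ℝ) ≤ ρ x := hρ x
  have h2 : ρ x ≤ c := hx
  exact_mod_cast (h1.trans h2).trans (Nat.le_ceil c)

/-- Some p(ρ) with ρ proper lies in J, and its zeros lie in a compact sublevel set of ρ. On the
compact set where s and p(ρ) both vanish, a finite sum of squares of elements of J is positive;
adding p(ρ)² and s² makes the result positive everywhere. -/
theorem exists_mem_isUnit_add_sq [FiniteDimensional ℝ E] [IsManifold 𝓘(ℝ, E) ∞ M] [T2Space M]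
    [SigmaCompactSpace M] {J : Ideal C^∞⟮𝓘(ℝ, E), M; ℝ⟯} (hJ : J.IsCoalgebraic)
    (s : C^∞⟮𝓘(ℝ, E), M; ℝ⟯) (hs : ∀ x, s x = 0 → ∃ f ∈ J, f x ≠ 0) :
    ∃ u ∈ J, IsUnit (u + s ^ 2) := by
  obtain ⟨ρ, hρ⟩ := exists_proper_smooth (E := E) (M := M)
  obtain ⟨p, hp, hpJ⟩ := hJ ρ
  let C : Set M := {x | s x = 0 ∧ p.eval (ρ x) = 0}
  have hC : IsCompact C := by
    obtain ⟨c, hc⟩ := p.roots.toFinset.bddAbove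
    refine (hρ c).of_isClosed_subset ?_ fun x hx => hc (by simpa [hp] using hx.2)
    exact (isClosed_eq s.contMDiff.continuous continuous_const).inter
      (isClosed_eq (p.continuous.comp ρ.contMDiff.continuous) continuous_const)
  have key : ∃ u ∈ J, (∀ x, 0 ≤ u x) ∧ ∀ x ∈ C, 0 < u x := by
    refine hC.induction_on (p := fun S => ∃ u ∈ J, (∀ x, 0 ≤ u x) ∧ ∀ x ∈ S, 0 < u x)
      ⟨0, J.zero_mem, fun x => le_rfl, by simp⟩ ?_ ?_ ?_
    · rintro S S' h ⟨u, hu, h0, h1⟩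
      exact ⟨u, hu, h0, fun x hx => h1 x (h hx)⟩
    · rintro S S' ⟨u, hu, h0, h1⟩ ⟨u', hu', h0', h1'⟩
      refine ⟨u + u', J.add_mem hu hu', fun x => add_nonneg (h0 x) (h0' x), ?_⟩
      rintro x (hx | hx)
      · exact add_pos_of_pos_of_nonneg (h1 x hx) (h0' x)
      · exact add_pos_of_nonneg_of_pos (h0 x) (h1' x hx)
    · intro x hx
      obtain ⟨f, hf, hfx⟩ := hs x hx.1
      refine ⟨{y | f y ≠ 0}, mem_nhdsWithin_of_mem_nhds
        (f.contMDiff.continuous.continuousAt.eventually_ne hfx), f * f, J.mul_mem_left _ hf,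
        fun y => mul_self_nonneg (f y), fun y hy => mul_self_pos.2 hy⟩
  obtain ⟨u, hu, h0, h1⟩ := key
  refine ⟨u + aeval ρ p * aeval ρ p, J.add_mem hu (J.mul_mem_left _ hpJ),
    isUnit_smooth_of_ne_zero fun x => ?_⟩
  have e : (u + aeval ρ p * aeval ρ p + s ^ 2) x
      = u x + p.eval (ρ x) * p.eval (ρ x) + s x ^ 2 := by
    rw [← aeval_smooth_apply, ← evalSmooth_apply, map_add, map_add, map_mul, map_pow]
    rfl
  rw [e]
  by_cases hx : x ∈ C
  · have h3 := h1 x hx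
    have h4 := mul_self_nonneg (p.eval (ρ x))
    have h5 := sq_nonneg (s x)
    linarith
  · have h2 := h0 x
    rcases not_and_or.1 hx with h | h
    · have h3 := pow_pos (abs_pos.2 h) 2
      rw [sq_abs] at h3
      have h4 := mul_self_nonneg (p.eval (ρ x))
      linarith
    · have h3 := mul_self_pos.2 h
      have h4 := sq_nonneg (s x)
      linarith

theorem exists_forall_mem_eq_zero [FiniteDimensional ℝ E] [IsManifold 𝓘(ℝ, E) ∞ M] [T2Space M]
    [SigmaCompactSpace M] {J : Ideal C^∞⟮𝓘(ℝ, E), M; ℝ⟯} (hJ : J.IsCoalgebraic) (hne : J ≠ ⊤) :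
    ∃ x, ∀ f ∈ J, f x = 0 := by
  by_contra! h
  obtain ⟨u, hu, hu'⟩ := exists_mem_isUnit_add_sq hJ 0 fun x _ => h x
  rw [zero_pow two_ne_zero, add_zero] at hu'
  exact hne (J.eq_top_of_isUnit_mem hu hu')

/-- J is nonzero somewhere at each zero of s, so some u ∈ J makes u + s² a unit, and f (u + s²) = f
u + (s f) s lies in J. -/
theorem mem_of_mul_mem_of_coalgebraic [FiniteDimensional ℝ E] [IsManifold 𝓘(ℝ, E) ∞ M] [T2Space M]
    [SigmaCompactSpace M] {J : Ideal C^∞⟮𝓘(ℝ, E), M; ℝ⟯} (hJ : J.IsCoalgebraic) {m : M}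
    (hm : ∀ x, (∀ f ∈ J, f x = 0) → x = m) {s f : C^∞⟮𝓘(ℝ, E), M; ℝ⟯} (hs : s m ≠ 0)
    (hsf : s * f ∈ J) : f ∈ J := by
  obtain ⟨u, hu, hu'⟩ := exists_mem_isUnit_add_sq hJ s fun x hx => by
    by_contra! h
    exact hs (hm x h ▸ hx)
  rw [← Ideal.mul_unit_mem_iff_mem _ hu', mul_add, pow_two, ← mul_assoc, mul_comm f s]
  exact J.add_mem (J.mul_mem_left _ hu) (J.mul_mem_right _ hsf)

/-- Powers of functions vanishing at the only zero of a coalgebraic ideal lie in the ideal. -/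
theorem exists_pow_mem_of_coalgebraic [FiniteDimensional ℝ E] [IsManifold 𝓘(ℝ, E) ∞ M] [T2Space M]
    [SigmaCompactSpace M] {J : Ideal C^∞⟮𝓘(ℝ, E), M; ℝ⟯} (hJ : J.IsCoalgebraic) {m : M}
    (hm : ∀ x, (∀ f ∈ J, f x = 0) → x = m) {f : C^∞⟮𝓘(ℝ, E), M; ℝ⟯} (hf : f m = 0) :
    ∃ n : ℕ, f ^ n ∈ J := by
  obtain ⟨p, hp, hpJ⟩ := hJ f
  -- Factor p = Xⁿ q with q(0) ≠ 0. Then q(f) is nonzero at m and can be cancelled from p(f) = fⁿ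
  -- q(f).
  obtain ⟨q, hq, hq'⟩ := Polynomial.exists_eq_pow_rootMultiplicity_mul_and_not_dvd p hp 0
  refine ⟨p.rootMultiplicity 0, mem_of_mul_mem_of_coalgebraic hJ hm (s := aeval f q) ?_ ?_⟩
  · rw [aeval_smooth_apply, hf]
    intro h
    exact hq' (Polynomial.dvd_iff_isRoot.2 h)
  · rw [hq] at hpJ
    simpa [mul_comm] using hpJ

end SmoothFunctions

/-! ### Maps to the plane with nowhere vanishing differential. -/

section GenericDifferential

/-- If the differential vanishes at x, put c = A x + b. Then A = −φ(x)⁻¹ (dg + dφ ⊗ c) and b = c − A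
x, so the bad pairs (A, b) are values of a C¹ map Ψ of (x, c). The image has Hausdorff dimension at
most dim E + dim F, less than dim E · dim F + dim F, so some pair is good. -/
theorem exists_affine_forall_fderiv_ne_zero {E F : Type*} [NormedAddCommGroup E] [NormedSpace ℝ E]
    [FiniteDimensional ℝ E] [NormedAddCommGroup F] [NormedSpace ℝ F] [FiniteDimensional ℝ F]
    (hE : 0 < Module.finrank ℝ E) (hF : 1 < Module.finrank ℝ F) {U : Set E} (hU : IsOpen U)
    {g : E → F} {φ : E → ℝ} (hg : ContDiffOn ℝ ∞ g U) (hφ : ContDiffOn ℝ ∞ φ U) :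
    ∃ (A : E →L[ℝ] F) (b : F), ∀ x ∈ U, φ x ≠ 0 →
      fderiv ℝ (fun y => g y + φ y • (A y + b)) x ≠ 0 := by
  let A : E × F → (E →L[ℝ] F) := fun p =>
    -(φ p.1)⁻¹ • (fderiv ℝ g p.1 + (fderiv ℝ φ p.1).smulRight p.2)
  let Ψ : E × F → (E →L[ℝ] F) × F := fun p => (A p, p.2 - A p p.1)
  let S : Set (E × F) := {p | p.1 ∈ U ∧ φ p.1 ≠ 0}
  have hΨ : ∀ p ∈ S, ContDiffAt ℝ 1 Ψ p := by
    intro p hp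
    have h1 : ContDiffAt ℝ ∞ φ p.1 := hφ.contDiffAt (hU.mem_nhds hp.1)
    have h2 : ContDiffAt ℝ ∞ g p.1 := hg.contDiffAt (hU.mem_nhds hp.1)
    have hφ1 : ContDiffAt ℝ 1 (fun p : E × F => φ p.1) p :=
      (h1.of_le (by norm_cast)).comp p contDiffAt_fst
    have hdφ : ContDiffAt ℝ 1 (fun p : E × F => fderiv ℝ φ p.1) p :=
      (h1.fderiv_right (m := 1) (by norm_cast)).comp p contDiffAt_fst
    have hdg : ContDiffAt ℝ 1 (fun p : E × F => fderiv ℝ g p.1) p :=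
      (h2.fderiv_right (m := 1) (by norm_cast)).comp p contDiffAt_fst
    have hA : ContDiffAt ℝ 1 A p :=
      (hφ1.inv hp.2).neg.smul (hdg.add (hdφ.smulRight contDiffAt_snd))
    exact hA.prodMk (contDiffAt_snd.sub (hA.clm_apply contDiffAt_fst))
  have hdim : dimH (Ψ '' S) < Module.finrank ℝ ((E →L[ℝ] F) × F) := by
    refine lt_of_le_of_lt (dimH_image_le_of_locally_lipschitzOn fun p hp => ?_) ?_
    · obtain ⟨K, t, ht, hK⟩ := (hΨ p hp).exists_lipschitzOnWith
      exact ⟨K, t, mem_nhdsWithin_of_mem_nhds ht, hK⟩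
    · refine (dimH_mono (Set.subset_univ S)).trans_lt ?_
      rw [Real.dimH_univ_eq_finrank]
      have e : Module.finrank ℝ (E →L[ℝ] F) = Module.finrank ℝ E * Module.finrank ℝ F := by
        rw [← LinearEquiv.finrank_eq (LinearMap.toContinuousLinearMap (𝕜 := ℝ) (E := E) (F' := F)),
          Module.finrank_linearMap]
      rw [Module.finrank_prod, Module.finrank_prod, e]
      have : Module.finrank ℝ E < Module.finrank ℝ E * Module.finrank ℝ F := by nlinarith
      exact_mod_cast (by omega)
  obtain ⟨⟨A₀, b⟩, hAb⟩ := (dense_compl_of_dimH_lt_finrank hdim).nonempty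
  refine ⟨A₀, b, fun x hx hφx h => hAb ⟨(x, A₀ x + b), ⟨hx, hφx⟩, ?_⟩⟩
  have d1 : HasFDerivAt φ (fderiv ℝ φ x) x :=
    ((hφ.contDiffAt (hU.mem_nhds hx)).differentiableAt (by simp)).hasFDerivAt
  have d2 : HasFDerivAt g (fderiv ℝ g x) x :=
    ((hg.contDiffAt (hU.mem_nhds hx)).differentiableAt (by simp)).hasFDerivAt
  have d3 : HasFDerivAt (fun y => A₀ y + b) A₀ x := A₀.hasFDerivAt.add_const b
  have d4 := (d2.add (d1.smul d3)).fderiv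
  have d5 : fderiv ℝ g x + (φ x • A₀ + (fderiv ℝ φ x).smulRight (A₀ x + b)) = 0 := by
    rw [← d4]; exact h
  have hA : A (x, A₀ x + b) = A₀ := by
    have : fderiv ℝ g x + (fderiv ℝ φ x).smulRight (A₀ x + b) = -(φ x • A₀) := by
      rw [eq_neg_iff_add_eq_zero, ← d5]; abel
    simp only [A]
    rw [this, neg_smul, smul_neg, neg_neg, smul_smul, inv_mul_cancel₀ hφx, one_smul]
  simp only [Ψ, hA, add_sub_cancel_left]

end GenericDifferential

section GenericMap

variable {E : Type*} [NormedAddCommGroup E] [NormedSpace ℝ E] [FiniteDimensional ℝ E]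
  {M : Type*} [TopologicalSpace M] [ChartedSpace E M] [IsManifold 𝓘(ℝ, E) ∞ M]
  {F : Type*} [NormedAddCommGroup F] [NormedSpace ℝ F] [FiniteDimensional ℝ F]

theorem exists_perturbation (hE : 0 < Module.finrank ℝ E) (hF : 1 < Module.finrank ℝ F) (x₀ : M)
    {H : M → F} (hH : ContMDiff 𝓘(ℝ, E) 𝓘(ℝ, F) ∞ H) {φ : M → ℝ}
    (hφ : ContMDiff 𝓘(ℝ, E) 𝓘(ℝ, ℝ) ∞ φ) (hφs : tsupport φ ⊆ (chartAt E x₀).source) :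
    ∃ H' : M → F, ContMDiff 𝓘(ℝ, E) 𝓘(ℝ, F) ∞ H' ∧ (∀ x, φ x = 0 → H' x = H x) ∧
      (∀ x, φ x = 0 → mvfderiv 𝓘(ℝ, E) H' x = mvfderiv 𝓘(ℝ, E) H x) ∧
      ∀ x, φ x ≠ 0 → mvfderiv 𝓘(ℝ, E) H' x ≠ 0 := by
  let e := extChartAt 𝓘(ℝ, E) x₀
  have htarget : IsOpen e.target := isOpen_extChartAt_target x₀
  have hsymm : ContMDiffOn 𝓘(ℝ, E) 𝓘(ℝ, E) ∞ e.symm e.target := contMDiffOn_extChartAt_symm x₀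
  -- The cutoff enters squared, so that neither the value nor the differential changes where φ
  -- vanishes.
  obtain ⟨A, b, hAb⟩ := exists_affine_forall_fderiv_ne_zero hE hF htarget
    (g := H ∘ e.symm) (φ := fun y => φ (e.symm y) * φ (e.symm y))
    (hH.comp_contMDiffOn hsymm).contDiffOn
    ((hφ.mul hφ).comp_contMDiffOn hsymm).contDiffOn
  let k : M → F := fun x => φ x • (A (e x) + b)
  have hk : ContMDiff 𝓘(ℝ, E) 𝓘(ℝ, F) ∞ k := by
    refine contMDiff_of_tsupport fun x hx => ?_
    have hxs : x ∈ (chartAt E x₀).source := hφs (tsupport_smul_subset_left _ _ hx)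
    have he : ContMDiffAt 𝓘(ℝ, E) 𝓘(ℝ, E) ∞ e x :=
      (contMDiffOn_extChartAt (n := ∞)).contMDiffAt ((chartAt E x₀).open_source.mem_nhds hxs)
    exact hφ.contMDiffAt.smul (((A.contMDiff.contMDiffAt).comp x he).add contMDiffAt_const)
  refine ⟨fun x => H x + φ x • k x, hH.add (hφ.smul hk), fun x hx => by simp [hx], ?_, ?_⟩
  · intro x hx
    have h1 := mvfderiv_add (I := 𝓘(ℝ, E)) (x := x) (hH.mdifferentiableAt (by simp))
      ((hφ.smul hk).mdifferentiableAt (by simp))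
    have h2 := mvfderiv_smul (I := 𝓘(ℝ, E)) (x := x) (hφ.mdifferentiableAt (by simp))
      (hk.mdifferentiableAt (by simp))
    refine h1.trans ?_
    have hkx : k x = 0 := by simp [k, hx]
    rw [h2, hx, hkx]
    ext v
    simp
  · intro x hx h0
    have hxs : x ∈ (chartAt E x₀).source := hφs (subset_tsupport _ hx)
    have hxe : x ∈ e.source := by simpa [e] using hxs
    have hxt : e x ∈ e.target := e.map_source hxe
    refine hAb (e x) hxt (by simpa [e.left_inv hxe] using hx) ?_
    have hd : MDifferentiableAt 𝓘(ℝ, E) 𝓘(ℝ, F) (fun x => H x + φ x • k x) (e.symm (e x)) :=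
      (hH.add (hφ.smul hk)).mdifferentiableAt (by simp)
    have hd' : MDifferentiableAt 𝓘(ℝ, E) 𝓘(ℝ, E) e.symm (e x) :=
      (hsymm.contMDiffAt (htarget.mem_nhds hxt)).mdifferentiableAt (by simp)
    have hc := mfderiv_comp (e x) hd hd'
    have h0' : mfderiv 𝓘(ℝ, E) 𝓘(ℝ, F) (fun x => H x + φ x • k x) (e.symm (e x)) = 0 := by
      rw [e.left_inv hxe]
      exact h0
    rw [h0'] at hc
    rw [← mfderiv_eq_fderiv]
    refine Eq.trans (Filter.EventuallyEq.mfderiv_eq ?_) (hc.trans ?_)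
    · filter_upwards [htarget.mem_nhds hxt] with y hy
      simp [k, e.right_inv hy, smul_smul]
    · exact ContinuousLinearMap.zero_comp _

/-- Perturb successively over countably many charts with a partition of unity. Local finiteness
makes the sequence locally stationary. At each point the last perturbation with φ n x ≠ 0 makes the
differential nonzero, and later ones leave it unchanged. -/
theorem exists_forall_mvfderiv_ne_zero [T2Space M] [SecondCountableTopology M]
    (hE : 0 < Module.finrank ℝ E) (hF : 1 < Module.finrank ℝ F) :
    ∃ H : M → F, ContMDiff 𝓘(ℝ, E) 𝓘(ℝ, F) ∞ H ∧ ∀ x, mvfderiv 𝓘(ℝ, E) H x ≠ 0 := by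
  classical
  rcases isEmpty_or_nonempty M with hM | hM
  · exact ⟨fun _ => 0, contMDiff_const, fun x => isEmptyElim x⟩
  have : LocallyCompactSpace M := ChartedSpace.locallyCompactSpace E M
  obtain ⟨s, hs, hsU⟩ := TopologicalSpace.countable_cover_nhds fun x : M =>
    (chartAt E x).open_source.mem_nhds (mem_chart_source E x)
  have hne : s.Nonempty := by
    by_contra h
    rw [Set.not_nonempty_iff_eq_empty] at h
    simp only [h, Set.mem_empty_iff_false, Set.iUnion_of_empty, Set.iUnion_empty] at hsU
    exact Set.empty_ne_univ hsU
  obtain ⟨c, rfl⟩ := hs.exists_eq_range hne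
  obtain ⟨φ, hφ⟩ := SmoothPartitionOfUnity.exists_isSubordinate 𝓘(ℝ, E) (s := Set.univ) (M := M)
    isClosed_univ (fun n => (chartAt E (c n)).source) (fun n => (chartAt E (c n)).open_source)
    (by rw [← hsU]; simp)
  have step : ∀ (n : ℕ) (H : C^∞⟮𝓘(ℝ, E), M; 𝓘(ℝ, F), F⟯), ∃ H' : C^∞⟮𝓘(ℝ, E), M; 𝓘(ℝ, F), F⟯,
      (∀ x, φ n x = 0 → H' x = H x) ∧
      (∀ x, φ n x = 0 → mvfderiv 𝓘(ℝ, E) H' x = mvfderiv 𝓘(ℝ, E) H x) ∧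
      ∀ x, φ n x ≠ 0 → mvfderiv 𝓘(ℝ, E) H' x ≠ 0 := fun n H => by
    obtain ⟨H', h1, h2⟩ := exists_perturbation hE hF (c n) H.contMDiff (φ n).contMDiff (hφ n)
    exact ⟨⟨H', h1⟩, h2⟩
  choose next hnext0 hnext1 hnext2 using step
  let H : ℕ → C^∞⟮𝓘(ℝ, E), M; 𝓘(ℝ, F), F⟯ := fun n => Nat.rec ⟨fun _ => 0, contMDiff_const⟩ next n
  have hsucc : ∀ n, H (n + 1) = next n (H n) := fun n => rfl
  have hloc : ∀ x : M, ∃ N, ∀ᶠ y in 𝓝 x, ∀ n, N ≤ n → φ n y = 0 := by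
    intro x
    obtain ⟨U, hU, hfin⟩ := φ.locallyFinite x
    obtain ⟨N, hN⟩ := hfin.bddAbove
    refine ⟨N + 1, Filter.mem_of_superset hU fun y hy n hn => ?_⟩
    by_contra h
    have := hN (show n ∈ _ from ⟨y, h, hy⟩)
    omega
  have hconst : ∀ (x : M) (N : ℕ), (∀ n, N ≤ n → φ n x = 0) → ∀ n, N ≤ n →
      H n x = H N x ∧ mvfderiv 𝓘(ℝ, E) (H n) x = mvfderiv 𝓘(ℝ, E) (H N) x := by
    intro x N hN n hn
    induction n, hn using Nat.le_induction with
    | base => exact ⟨rfl, rfl⟩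
    | succ n hn ih =>
      rw [hsucc, hnext0 n _ x (hN n hn), hnext1 n _ x (hN n hn)]
      exact ih
  choose N hN using hloc
  have hlim : ∀ x : M, (fun y => H (N y) y) =ᶠ[𝓝 x] H (N x) := by
    intro x
    filter_upwards [hN x] with y hy
    have h1 := (hconst y _ (hN y).self_of_nhds _ (le_max_left (N y) (N x))).1
    have h2 := (hconst y _ hy _ (le_max_right (N y) (N x))).1
    exact h1.symm.trans h2
  refine ⟨fun y => H (N y) y, fun x => (H (N x)).contMDiff.contMDiffAt.congr_of_eventuallyEq (hlim x),
    fun x h0 => ?_⟩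
  have h1 : mvfderiv 𝓘(ℝ, E) (H (N x)) x = 0 := by
    rw [← h0]
    exact (hlim x).mfderiv_eq.symm
  -- The predecessor of the least such bound is the last index whose function is nonzero at x.
  have hfind : ∃ K, ∀ n, K ≤ n → φ n x = 0 := ⟨_, (hN x).self_of_nhds⟩
  obtain ⟨j, hj⟩ := φ.exists_pos_of_mem (Set.mem_univ x)
  have hK0 : Nat.find hfind ≠ 0 := fun h =>
    hj.ne' (Nat.find_spec hfind j (by omega))
  obtain ⟨K, hK⟩ := Nat.exists_eq_succ_of_ne_zero hK0
  have hφK : φ K x ≠ 0 := by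
    intro hz
    refine Nat.find_min hfind (m := K) (by omega) fun n hn => ?_
    rcases hn.eq_or_lt with rfl | hlt
    · exact hz
    · exact Nat.find_spec hfind n (by omega)
  have h2 := hconst x _ (Nat.find_spec hfind) (N x) (Nat.find_min' hfind (hN x).self_of_nhds)
  rw [hK] at h2
  exact hnext2 K (H K) x hφK (h2.2.symm.trans h1)

/-- Two functions are taken because a single one has critical points whenever M is compact and
nonempty. -/
theorem exists_two_functions_mvfderiv_ne_zero [T2Space M] [SecondCountableTopology M]
    (hE : 0 < Module.finrank ℝ E) :
    ∃ h₁ h₂ : C^∞⟮𝓘(ℝ, E), M; ℝ⟯, ∀ x,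
      mvfderiv 𝓘(ℝ, E) h₁ x ≠ 0 ∨ mvfderiv 𝓘(ℝ, E) h₂ x ≠ 0 := by
  obtain ⟨H, hH, hne⟩ := exists_forall_mvfderiv_ne_zero (M := M) (F := ℝ × ℝ) hE (by simp)
  have e : ∀ (l : ℝ × ℝ →L[ℝ] ℝ) (x : M) (v : TangentSpace 𝓘(ℝ, E) x),
      mvfderiv 𝓘(ℝ, E) (l ∘ H) x v = l (mvfderiv 𝓘(ℝ, E) H x v) := by
    intro l x v
    have h := mfderiv_comp (I := 𝓘(ℝ, E)) (I' := 𝓘(ℝ, ℝ × ℝ)) (I'' := 𝓘(ℝ, ℝ)) x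
      ((l.contMDiff (n := ∞)).mdifferentiableAt (by simp)) (hH.mdifferentiableAt (by simp))
    rw [mfderiv_eq_fderiv, l.fderiv] at h
    exact congrArg (fun k => k v) h
  refine ⟨⟨_, (ContinuousLinearMap.fst ℝ ℝ ℝ).contMDiff.comp hH⟩,
    ⟨_, (ContinuousLinearMap.snd ℝ ℝ ℝ).contMDiff.comp hH⟩, fun x => ?_⟩
  by_contra! h
  apply hne x
  ext v
  · rw [← ContinuousLinearMap.coe_fst' (R := ℝ), ← e]
    exact congrArg (fun k => k v) h.1
  · rw [← ContinuousLinearMap.coe_snd' (R := ℝ), ← e]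
    exact congrArg (fun k => k v) h.2

end GenericMap

/-! ### Ideals of semisimple Lie algebras. -/

section Semisimple

variable {g : Type*} [LieRing g] [LieAlgebra ℝ g]

/-- The part of I in the complement of [I, I] is an abelian ideal, hence zero. -/
theorem LieIdeal.lie_self_eq_of_isSemisimple [LieAlgebra.IsSemisimple ℝ g]
    (I : LieIdeal ℝ g) : ⁅I, I⁆ = I := by
  have hrad : LieAlgebra.HasTrivialRadical ℝ g := inferInstance
  have hle : ⁅I, I⁆ ≤ I := LieSubmodule.lie_le_left _ _
  have hA : I ⊓ ⁅I, I⁆ᶜ = ⊥ := by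
    refine (LieAlgebra.hasTrivialRadical_iff_no_abelian_ideals ℝ g).1 hrad _ ?_
    rw [LieSubmodule.lie_abelian_iff_lie_self_eq_bot, eq_bot_iff]
    calc ⁅I ⊓ ⁅I, I⁆ᶜ, I ⊓ ⁅I, I⁆ᶜ⁆ ≤ ⁅I, I⁆ ⊓ ⁅I, I⁆ᶜ :=
          le_inf (LieSubmodule.mono_lie inf_le_left inf_le_left)
            ((LieSubmodule.lie_le_left _ _).trans inf_le_right)
      _ ≤ ⊥ := by rw [inf_compl_self]
  refine le_antisymm hle ?_
  rw [← disjoint_iff] at hA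
  simpa using hA.le_compl_right

/-- Were x in every coatom, the ideal S generated by x would lie in the complement of every atom.
Then Sᶜ contains all atoms, so Sᶜ = ⊤ and S = ⊥. -/
theorem LieIdeal.exists_isCoatom_notMem [LieAlgebra.IsSemisimple ℝ g] {x : g} (hx : x ≠ 0) :
    ∃ I : LieIdeal ℝ g, IsCoatom I ∧ x ∉ I := by
  by_contra! h
  let S : LieIdeal ℝ g := LieSubmodule.lieSpan ℝ g {x}
  have hS : Sᶜ = ⊤ := by
    rw [eq_top_iff, ← LieAlgebra.IsSemisimple.sSup_atoms_eq_top]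
    refine sSup_le fun a ha => ?_
    have : S ≤ aᶜ := by
      rw [LieSubmodule.lieSpan_le, Set.singleton_subset_iff]
      exact h _ (isCoatom_compl.2 ha)
    exact le_compl_comm.1 this
  have hS' : S = ⊥ := by simpa using hS
  apply hx
  have : x ∈ S := LieSubmodule.subset_lieSpan rfl
  rw [hS'] at this
  simpa using this

end Semisimple

/-! ### Local sections and extension to invariant vector fields. -/

theorem ContMDiffOn.mfderiv_partial_left {E E' E'' EN : Type*}
    [NormedAddCommGroup E] [NormedSpace ℝ E] [NormedAddCommGroup E'] [NormedSpace ℝ E']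
    [NormedAddCommGroup E''] [NormedSpace ℝ E''] [NormedAddCommGroup EN] [NormedSpace ℝ EN]
    {M M' M'' N : Type*} [TopologicalSpace M] [ChartedSpace E M] [IsManifold 𝓘(ℝ, E) ∞ M]
    [TopologicalSpace M'] [ChartedSpace E' M'] [IsManifold 𝓘(ℝ, E') ∞ M']
    [TopologicalSpace M''] [ChartedSpace E'' M''] [IsManifold 𝓘(ℝ, E'') ∞ M'']
    [TopologicalSpace N] [ChartedSpace EN N]
    {F : M × M' → M''} (hF : ContMDiff (𝓘(ℝ, E).prod 𝓘(ℝ, E')) 𝓘(ℝ, E'') ∞ F)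
    {a : N → TangentBundle 𝓘(ℝ, E) M} {b : N → TangentBundle 𝓘(ℝ, E') M'} {s : Set N}
    (ha : ContMDiffOn 𝓘(ℝ, EN) 𝓘(ℝ, E).tangent ∞ a s)
    (hb : ContMDiffOn 𝓘(ℝ, EN) 𝓘(ℝ, E').tangent ∞ b s) :
    ContMDiffOn 𝓘(ℝ, EN) 𝓘(ℝ, E'').tangent ∞
      (fun n => (⟨F ((a n).1, (b n).1),
        (mfderiv 𝓘(ℝ, E) 𝓘(ℝ, E'') (fun z => F (z, (b n).1)) (a n).1 (a n).2 : E'') +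
        (mfderiv 𝓘(ℝ, E') 𝓘(ℝ, E'') (fun z => F ((a n).1, z)) (b n).1 (b n).2 : E'')⟩ :
        TangentBundle 𝓘(ℝ, E'') M'')) s := by
  -- The sum of the partial derivatives is the tangent map of F on T(M × M') ≅ TM × TM', which is
  -- smooth. Inserting a zero section for one argument isolates a single partial derivative; this is
  -- how fields produced by a group action are shown smooth.
  have h1 : ContMDiff (𝓘(ℝ, E).prod 𝓘(ℝ, E')).tangent 𝓘(ℝ, E'').tangent ∞
      (tangentMap (𝓘(ℝ, E).prod 𝓘(ℝ, E')) 𝓘(ℝ, E'') F) := hF.contMDiff_tangentMap (by rfl)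
  have h2 := (h1.comp (contMDiff_equivTangentBundleProd_symm (I := 𝓘(ℝ, E)) (M := M)
    (I' := 𝓘(ℝ, E')) (M' := M'))).comp_contMDiffOn (ha.prodMk hb)
  refine h2.congr fun n _ => ?_
  let v : TangentSpace (𝓘(ℝ, E).prod 𝓘(ℝ, E')) ((a n).1, (b n).1) := ((a n).2, (b n).2)
  have h3 := mfderiv_prod_eq_add_apply (v := v) (hF.mdifferentiableAt (by simp))
  exact congrArg (Bundle.TotalSpace.mk (F ((a n).1, (b n).1))) h3.symm

namespace SmoothPrincipalBundle

variable {EM EG EP : Type*} [NormedAddCommGroup EM] [NormedSpace ℝ EM] [FiniteDimensional ℝ EM]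
  [NormedAddCommGroup EG] [NormedSpace ℝ EG]
  [NormedAddCommGroup EP] [NormedSpace ℝ EP] [FiniteDimensional ℝ EP]
  {M G P : Type*} [TopologicalSpace M] [ChartedSpace EM M] [IsManifold 𝓘(ℝ, EM) ∞ M]
  [TopologicalSpace G] [ChartedSpace EG G] [Group G] [LieGroup 𝓘(ℝ, EG) ∞ G]
  [TopologicalSpace P] [ChartedSpace EP P] [IsManifold 𝓘(ℝ, EP) ∞ P]
  (B : SmoothPrincipalBundle EM EG EP M G P)

/-- A smooth section `σ` over an open set `U`, together with the map `γ` determined by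
`u = σ(π(u)).γ(u)`. -/
structure LocalSection where
  base : Set M
  section' : M → P
  coord : P → G
  isOpen_base : IsOpen base
  contMDiffOn_section : ContMDiffOn 𝓘(ℝ, EM) 𝓘(ℝ, EP) ∞ section' base
  contMDiffOn_coord : ContMDiffOn 𝓘(ℝ, EP) 𝓘(ℝ, EG) ∞ coord (B.proj ⁻¹' base)
  proj_section : ∀ x ∈ base, B.proj (section' x) = x
  act_coord : ∀ u, B.proj u ∈ base → B.act (section' (B.proj u)) (coord u) = u
  coord_act : ∀ u g, B.proj u ∈ base → coord (B.act u g) = coord u * g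
  coord_section : ∀ x ∈ base, coord (section' x) = 1

theorem exists_localSection (m : M) : ∃ S : B.LocalSection, m ∈ S.base := by
  obtain ⟨e, hm, he, hes, hact⟩ := B.exists_trivialization m
  have hmem : ∀ x ∈ e.baseSet, (x, (1 : G)) ∈ e.target := fun x hx => by rwa [e.mem_target]
  have hproj : ∀ x ∈ e.baseSet, B.proj (e.toOpenPartialHomeomorph.symm (x, 1)) = x :=
    fun x hx => e.proj_symm_apply' hx
  have hsec : ∀ x ∈ e.baseSet, (e (e.toOpenPartialHomeomorph.symm (x, 1))).2 = 1 := fun x hx => by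
    rw [e.apply_symm_apply' hx]
  refine ⟨⟨e.baseSet, fun x => e.toOpenPartialHomeomorph.symm (x, 1), fun u => (e u).2,
    e.open_baseSet, ?_, ?_, hproj, ?_, hact, hsec⟩, hm⟩
  · exact hes.comp (contMDiff_id.prodMk contMDiff_const).contMDiffOn hmem
  · rw [← e.source_eq]
    exact contMDiff_snd.comp_contMDiffOn he
  · intro u hu
    have hu1 : B.proj (e.toOpenPartialHomeomorph.symm (B.proj u, 1)) = B.proj u := hproj _ hu
    have hu2 : B.act (e.toOpenPartialHomeomorph.symm (B.proj u, 1)) (e u).2 ∈ e.source := by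
      rw [e.mem_source, B.proj_act, hu1]; exact hu
    apply e.injOn hu2 (e.mem_source.2 hu)
    apply Prod.ext
    · refine (e.coe_fst hu2).trans ?_
      rw [B.proj_act, hu1]
      exact (e.coe_fst' hu).symm
    · refine (hact _ _ (by rwa [hu1])).trans ?_
      rw [hsec _ hu, one_mul]
      rfl

variable {B}

namespace LocalSection

variable (S : B.LocalSection)

/-- The invariant vector field that extends the field `Y` along the section. -/
noncomputable def extendFun (Y : M → EP) (u : P) : EP :=
  mfderiv 𝓘(ℝ, EP) 𝓘(ℝ, EP) (fun p => B.act p (S.coord u)) (S.section' (B.proj u)) (Y (B.proj u))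

theorem contMDiffOn_extendFun {Y : M → EP} {V : Set M} (hVS : V ⊆ S.base)
    (hY : ContMDiffOn 𝓘(ℝ, EM) 𝓘(ℝ, EP).tangent ∞
      (fun x => (⟨S.section' x, Y x⟩ : TangentBundle 𝓘(ℝ, EP) P)) V) :
    ContMDiffOn 𝓘(ℝ, EP) 𝓘(ℝ, EP).tangent ∞
      (fun u => (⟨u, S.extendFun Y u⟩ : TangentBundle 𝓘(ℝ, EP) P)) (B.proj ⁻¹' V) := by
  have h1 : ContMDiffOn 𝓘(ℝ, EP) 𝓘(ℝ, EP).tangent ∞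
      (fun u => (⟨S.section' (B.proj u), Y (B.proj u)⟩ : TangentBundle 𝓘(ℝ, EP) P))
      (B.proj ⁻¹' V) := hY.comp B.contMDiff_proj.contMDiffOn (Set.Subset.refl _)
  have h2 : ContMDiffOn 𝓘(ℝ, EP) 𝓘(ℝ, EG).tangent ∞
      (fun u => (⟨S.coord u, 0⟩ : TangentBundle 𝓘(ℝ, EG) G)) (B.proj ⁻¹' V) :=
    (Bundle.contMDiff_zeroSection ℝ (TangentSpace 𝓘(ℝ, EG) : G → Type _)).comp_contMDiffOn
      (S.contMDiffOn_coord.mono (Set.preimage_mono hVS))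
  refine (ContMDiffOn.mfderiv_partial_left B.contMDiff_act h1 h2).congr fun u hu => ?_
  have e := S.act_coord u (hVS hu)
  refine Bundle.TotalSpace.ext e.symm (heq_of_eq ?_)
  refine Eq.trans ?_ (congrArg (S.extendFun Y u + ·)
    (map_zero (mfderiv 𝓘(ℝ, EG) 𝓘(ℝ, EP) (fun z => B.act (S.section' (B.proj u)) z) (S.coord u)))).symm
  exact (add_zero _).symm

theorem extendFun_act (Y : M → EP) {u : P} (hu : B.proj u ∈ S.base) (g : G) :
    S.extendFun Y (B.act u g)
      = mfderiv 𝓘(ℝ, EP) 𝓘(ℝ, EP) (fun p => B.act p g) u (S.extendFun Y u) := by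
  have h1 : MDifferentiableAt 𝓘(ℝ, EP) 𝓘(ℝ, EP) (fun p => B.act p (S.coord u))
      (S.section' (B.proj u)) := (B.contMDiff_act_right _).mdifferentiableAt (by simp)
  have h2 : MDifferentiableAt 𝓘(ℝ, EP) 𝓘(ℝ, EP) (fun p => B.act p g)
      (B.act (S.section' (B.proj u)) (S.coord u)) :=
    (B.contMDiff_act_right _).mdifferentiableAt (by simp)
  have h3 := mfderiv_comp (I' := 𝓘(ℝ, EP)) (S.section' (B.proj u)) h2 h1
  rw [S.act_coord u hu] at h3
  have h4 : (fun p => B.act p g) ∘ (fun p => B.act p (S.coord u))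
      = fun p => B.act p (S.coord (B.act u g)) := by
    funext p
    simp [S.coord_act u g hu, B.act_mul]
  rw [h4] at h3
  unfold extendFun
  rw [B.proj_act]
  exact congrArg (fun l => l (Y (B.proj u))) h3

theorem extendFun_section (Y : M → EP) {x : M} (hx : x ∈ S.base) :
    S.extendFun Y (S.section' x) = Y x := by
  unfold extendFun
  rw [S.coord_section x hx, S.proj_section x hx]
  have : (fun p => B.act p 1) = id := funext fun p => B.act_one p
  rw [this, mfderiv_id]
  rfl

/-- The invariant vector field on `P` that extends `f • Y`, for `f` supported in the domain. -/
noncomputable def extend (f : C^∞⟮𝓘(ℝ, EM), M; ℝ⟯) {V : Set M} (hV : IsOpen V)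
    (hVS : V ⊆ S.base) (hf : tsupport f ⊆ V) {Y : M → EP}
    (hY : ContMDiffOn 𝓘(ℝ, EM) 𝓘(ℝ, EP).tangent ∞
      (fun x => (⟨S.section' x, Y x⟩ : TangentBundle 𝓘(ℝ, EP) P)) V) : B.atiyahAlgebra :=
  ⟨⟨fun u => f (B.proj u) • S.extendFun Y u,
    ContMDiffOn.smul_section_of_tsupport (u := B.proj ⁻¹' V) (ψ := f ∘ B.proj)
      (f.contMDiff.comp B.contMDiff_proj).contMDiffOn (hV.preimage B.contMDiff_proj.continuous)
      ((tsupport_comp_subset_preimage f B.contMDiff_proj.continuous).trans (Set.preimage_mono hf))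
      (S.contMDiffOn_extendFun hVS hY)⟩, fun g u => by
    refine (map_smul _ _ _).trans ?_
    change f (B.proj u) • _ = f (B.proj (B.act u g)) • S.extendFun Y (B.act u g)
    rw [B.proj_act]
    by_cases hu : B.proj u ∈ S.base
    · rw [S.extendFun_act Y hu g]
    · have : f (B.proj u) = 0 := by
        by_contra h
        exact hu (hVS (hf (subset_tsupport _ h)))
      rw [this, zero_smul]
      exact zero_smul ℝ _⟩

theorem extend_section (f : C^∞⟮𝓘(ℝ, EM), M; ℝ⟯) {V : Set M} (hV : IsOpen V)
    (hVS : V ⊆ S.base) (hf : tsupport f ⊆ V) {Y : M → EP}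
    (hY : ContMDiffOn 𝓘(ℝ, EM) 𝓘(ℝ, EP).tangent ∞
      (fun x => (⟨S.section' x, Y x⟩ : TangentBundle 𝓘(ℝ, EP) P)) V) {x : M} (hx : x ∈ S.base) :
    ((S.extend f hV hVS hf hY).1 (S.section' x) : EP) = f x • Y x := by
  change f (B.proj (S.section' x)) • S.extendFun Y (S.section' x) = _
  rw [S.extendFun_section Y hx, S.proj_section x hx]

theorem extend_eq_zero (f : C^∞⟮𝓘(ℝ, EM), M; ℝ⟯) {V : Set M} (hV : IsOpen V)
    (hVS : V ⊆ S.base) (hf : tsupport f ⊆ V) {Y : M → EP}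
    (hY : ContMDiffOn 𝓘(ℝ, EM) 𝓘(ℝ, EP).tangent ∞
      (fun x => (⟨S.section' x, Y x⟩ : TangentBundle 𝓘(ℝ, EP) P)) V) {u : P} (hu : f (B.proj u) = 0) :
    (S.extend f hV hVS hf hY).1 u = 0 := by
  change f (B.proj u) • S.extendFun Y u = 0
  rw [hu, zero_smul]

theorem mfderiv_proj_section {x : M} (hx : x ∈ S.base) (w : EM) :
    (mfderiv 𝓘(ℝ, EP) 𝓘(ℝ, EM) B.proj (S.section' x)
      (mfderiv 𝓘(ℝ, EM) 𝓘(ℝ, EP) S.section' x w) : EM) = w := by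
  have h1 : MDifferentiableAt 𝓘(ℝ, EM) 𝓘(ℝ, EP) S.section' x :=
    (S.contMDiffOn_section.contMDiffAt (S.isOpen_base.mem_nhds hx)).mdifferentiableAt (by simp)
  have h2 : MDifferentiableAt 𝓘(ℝ, EP) 𝓘(ℝ, EM) B.proj (S.section' x) :=
    B.contMDiff_proj.mdifferentiableAt (by simp)
  have h3 := mfderiv_comp _ h2 h1
  have h4 : B.proj ∘ S.section' =ᶠ[𝓝 x] id := by
    filter_upwards [S.isOpen_base.mem_nhds hx] with y hy
    exact S.proj_section y hy
  rw [h4.mfderiv_eq, mfderiv_id] at h3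
  exact (congrArg (fun l => l w) h3).symm

end LocalSection

variable (B)

theorem _root_.exists_smooth_bump [T2Space M] {V : Set M} (hV : IsOpen V) {m : M} (hm : m ∈ V) :
    ∃ f : C^∞⟮𝓘(ℝ, EM), M; ℝ⟯, f m = 1 ∧ tsupport f ⊆ V := by
  obtain ⟨f, -, hf⟩ := (SmoothBumpFunction.nhds_basis_tsupport (I := 𝓘(ℝ, EM)) m).mem_iff.1
    (hV.mem_nhds hm)
  exact ⟨⟨f, f.contMDiff⟩, f.eq_one, hf⟩

/-- Lift w by the differential of a local section σ, extend the lift to a vector field on an open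
set of P, restrict that field to σ, cut it off and spread it by the group action. -/
theorem exists_anchor_eq [T2Space M] (m : M) (w : TangentSpace 𝓘(ℝ, EM) m) :
    ∃ a : B.atiyahAlgebra, B.anchor a m = w := by
  obtain ⟨S, hm⟩ := B.exists_localSection m
  let z : TangentSpace 𝓘(ℝ, EP) (S.section' m) := mfderiv 𝓘(ℝ, EM) 𝓘(ℝ, EP) S.section' m w
  obtain ⟨s, hs, hZ⟩ := FiberBundle.exists_contMDiffOn_extend (k := ∞) 𝓘(ℝ, EP) EP z
  obtain ⟨t, hts, ht, hmt⟩ := mem_nhds_iff.1 hs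
  have hV := S.contMDiffOn_section.continuousOn.isOpen_inter_preimage S.isOpen_base ht
  obtain ⟨f, hfm, hf⟩ := exists_smooth_bump (EM := EM) hV ⟨hm, hmt⟩
  have hY := (hZ.mono hts).comp (S.contMDiffOn_section.mono Set.inter_subset_left)
    (fun x (hx : x ∈ S.base ∩ S.section' ⁻¹' t) => hx.2)
  refine ⟨S.extend f hV Set.inter_subset_left hf hY, ?_⟩
  have h1 := B.anchor_proj (S.extend f hV Set.inter_subset_left hf hY) (S.section' m)
  rw [S.proj_section m hm] at h1
  have h2 : ((S.extend f hV Set.inter_subset_left hf hY).1 (S.section' m) : EP) = z := by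
    rw [S.extend_section f hV Set.inter_subset_left hf hY hm, hfm]
    exact (one_smul ℝ (FiberBundle.extend EP z (S.section' m) : EP)).trans
      (FiberBundle.extend_apply_self EP z)
  exact h1.trans ((congrArg (mfderiv 𝓘(ℝ, EP) 𝓘(ℝ, EM) B.proj (S.section' m)) h2).trans
    (S.mfderiv_proj_section hm w))

end SmoothPrincipalBundle

/-! ### A unit that is a sum of squares of derivatives. -/

namespace SmoothPrincipalBundle

variable {EM EG EP : Type*} [NormedAddCommGroup EM] [NormedSpace ℝ EM] [FiniteDimensional ℝ EM]
  [NormedAddCommGroup EG] [NormedSpace ℝ EG]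
  [NormedAddCommGroup EP] [NormedSpace ℝ EP] [FiniteDimensional ℝ EP]
  {M G P : Type*} [TopologicalSpace M] [ChartedSpace EM M] [IsManifold 𝓘(ℝ, EM) ∞ M]
  [TopologicalSpace G] [ChartedSpace EG G] [Group G] [LieGroup 𝓘(ℝ, EG) ∞ G]
  [TopologicalSpace P] [ChartedSpace EP P] [IsManifold 𝓘(ℝ, EP) ∞ P]
  (B : SmoothPrincipalBundle EM EG EP M G P)

theorem exists_locally_finite_sum {ι : Type*} (ρ : SmoothPartitionOfUnity ι 𝓘(ℝ, EM) M)
    (b : ι → B.atiyahAlgebra) :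
    ∃ a : B.atiyahAlgebra, ∀ (h : C^∞⟮𝓘(ℝ, EM), M; ℝ⟯) (x : M),
      B.anchorDerivation a h x = ∑ᶠ i, ρ i x * B.anchorDerivation (b i) h x := by
  have hloc : LocallyFinite fun i => {u : P | ρ i (B.proj u) • (b i).1 u ≠ 0} :=
    (ρ.locallyFinite.preimage_continuous B.contMDiff_proj.continuous).subset fun i u hu h => by
      change ρ i (B.proj u) • (b i).1 u ≠ 0 at hu
      rw [h, zero_smul] at hu
      exact hu rfl
  have hfin : ∀ u, (Function.support fun i => ρ i (B.proj u) • (b i).1 u).Finite :=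
    fun u => hloc.point_finite u
  let a : B.atiyahAlgebra := ⟨⟨fun u => ∑ᶠ i, ρ i (B.proj u) • (b i).1 u,
    ContMDiff.finsum_section_of_locallyFinite hloc fun i =>
      ((ρ i).contMDiff.comp B.contMDiff_proj).smul_section (b i).1.contMDiff⟩, fun g u => by
    refine ((mfderiv 𝓘(ℝ, EP) 𝓘(ℝ, EP) (fun p => B.act p g) u).toLinearMap.toAddMonoidHom.map_finsum
      (hfin u)).trans ?_
    refine finsum_congr fun i => ?_
    refine (map_smul (mfderiv 𝓘(ℝ, EP) 𝓘(ℝ, EP) (fun p => B.act p g) u) _ _).trans ?_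
    rw [B.proj_act]
    exact congrArg (ρ i (B.proj u) • ·) ((b i).2 g u)⟩
  refine ⟨a, fun h x => ?_⟩
  obtain ⟨u, rfl⟩ := B.proj_surjective x
  let l : TangentSpace 𝓘(ℝ, EP) u →L[ℝ] ℝ := (mvfderiv 𝓘(ℝ, EM) h (B.proj u)).comp
    (mfderiv 𝓘(ℝ, EP) 𝓘(ℝ, EM) B.proj u)
  have hl : ∀ c : B.atiyahAlgebra, B.anchorDerivation c h (B.proj u) = l (c.1 u) := fun c => by
    rw [anchorDerivation_apply, anchor_proj]
    rfl
  rw [hl]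
  refine (l.toLinearMap.toAddMonoidHom.map_finsum (hfin u)).trans (finsum_congr fun i => ?_)
  rw [hl]
  exact map_smul l _ _

/-- Near each point x some field b_x has positive derivative on one of the two functions, h_{i(x)}.
Let a_j collect, with a partition of unity, the b_x with i(x) = j. Then ∑ a_j(h_j) > 0 everywhere,
so the a_j(h_j) never vanish simultaneously. -/
theorem exists_isUnit_sum_sq [T2Space M] [SecondCountableTopology M]
    (hM : 0 < Module.finrank ℝ EM) :
    ∃ (a : Fin 2 → B.atiyahAlgebra) (h : Fin 2 → C^∞⟮𝓘(ℝ, EM), M; ℝ⟯),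
      IsUnit (∑ i, B.anchorDerivation (a i) (h i) ^ 2) := by
  have : LocallyCompactSpace M := ChartedSpace.locallyCompactSpace EM M
  obtain ⟨h₁, h₂, hne⟩ := exists_two_functions_mvfderiv_ne_zero (M := M) hM
  let h : Fin 2 → C^∞⟮𝓘(ℝ, EM), M; ℝ⟯ := ![h₁, h₂]
  have hloc : ∀ x : M, ∃ (i : Fin 2) (b : B.atiyahAlgebra), 0 < B.anchorDerivation b (h i) x := by
    intro x
    have hi : ∃ i, mvfderiv 𝓘(ℝ, EM) (h i) x ≠ 0 := by
      rcases hne x with h' | h'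
      · exact ⟨0, h'⟩
      · exact ⟨1, h'⟩
    obtain ⟨i, hi⟩ := hi
    have hw : ∃ w, mvfderiv 𝓘(ℝ, EM) (h i) x w ≠ 0 := by
      by_contra! h0
      exact hi (ContinuousLinearMap.ext h0)
    obtain ⟨w, hw⟩ := hw
    obtain ⟨b, hb⟩ := B.exists_anchor_eq x (mvfderiv 𝓘(ℝ, EM) (h i) x w • w)
    refine ⟨i, b, ?_⟩
    rw [anchorDerivation_apply, hb, map_smul]
    exact mul_self_pos.2 hw
  choose i b hpos using hloc
  obtain ⟨ρ, hρ⟩ := SmoothPartitionOfUnity.exists_isSubordinate 𝓘(ℝ, EM) (s := Set.univ) (M := M)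
    isClosed_univ (fun x => {y | 0 < B.anchorDerivation (b x) (h (i x)) y})
    (fun x => isOpen_lt continuous_const (ContMDiffMap.contMDiff _).continuous)
    (fun x _ => Set.mem_iUnion.2 ⟨x, hpos x⟩)
  choose a ha using fun j : Fin 2 =>
    B.exists_locally_finite_sum ρ fun x => if i x = j then b x else 0
  refine ⟨a, h, isUnit_smooth_of_ne_zero fun y => ?_⟩
  have key : 0 < ∑ j, B.anchorDerivation (a j) (h j) y := by
    have e : ∑ j, B.anchorDerivation (a j) (h j) y
        = ∑ᶠ x, ρ x y * B.anchorDerivation (b x) (h (i x)) y := by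
      have hfin : ∀ F : M → ℝ, (Function.support fun x => ρ x y * F x).Finite := fun F =>
        (ρ.locallyFinite.point_finite y).subset fun x hx => left_ne_zero_of_mul hx
      rw [Finset.sum_congr rfl fun j _ => ha j (h j) y,
        ← finsum_sum_comm _ _ fun j _ => hfin _]
      refine finsum_congr fun x => ?_
      rw [← Finset.mul_sum]
      congr 1
      rw [Finset.sum_eq_single (i x)]
      · rw [if_pos rfl]
      · intro j _ hj
        rw [if_neg hj.symm, map_zero]
        rfl
      · simp
    rw [e]
    obtain ⟨x, hx⟩ := ρ.exists_pos_of_mem (Set.mem_univ y)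
    have hmem : ∀ x, ρ x y ≠ 0 → 0 < B.anchorDerivation (b x) (h (i x)) y := fun x hx =>
      hρ x (subset_tsupport _ hx)
    refine finsum_pos (fun x => ?_) ⟨x, mul_pos hx (hmem x hx.ne')⟩
      ((ρ.locallyFinite.point_finite y).subset fun x hx => left_ne_zero_of_mul hx)
    by_cases hx0 : ρ x y = 0
    · rw [hx0, zero_mul]
    · exact mul_nonneg (ρ.nonneg x y) (hmem x hx0).le
  have e2 : (∑ j, B.anchorDerivation (a j) (h j) ^ 2 : C^∞⟮𝓘(ℝ, EM), M; ℝ⟯) y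
      = ∑ j, (B.anchorDerivation (a j) (h j) y) ^ 2 := by
    rw [← evalSmooth_apply, map_sum]
    exact Finset.sum_congr rfl fun j _ => map_pow _ _ _
  rw [e2]
  intro h0
  rw [Finset.sum_eq_zero_iff_of_nonneg fun j _ => sq_nonneg _] at h0
  rw [Finset.sum_eq_zero fun j hj => pow_eq_zero_iff two_ne_zero |>.1 (h0 j hj)] at key
  exact key.false

end SmoothPrincipalBundle

/-! ### Evaluation of the kernel at a point, with values in the Lie algebra of G. -/

section LeftInvariant

variable {EG : Type*} [NormedAddCommGroup EG] [NormedSpace ℝ EG] [FiniteDimensional ℝ EG]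
  {G : Type*} [TopologicalSpace G] [ChartedSpace EG G] [Group G] [LieGroup 𝓘(ℝ, EG) ∞ G]

/-- The left invariant vector field given by an element of the Lie algebra. -/
noncomputable def leftInvariantField (ξ : GroupLieAlgebra 𝓘(ℝ, EG) G) : SmoothVectorField EG G :=
  ⟨mulInvariantVectorField ξ, by
    have h1 : ContMDiff 𝓘(ℝ, EG) 𝓘(ℝ, EG).tangent ∞
        (fun g : G => (⟨g, 0⟩ : TangentBundle 𝓘(ℝ, EG) G)) :=
      Bundle.contMDiff_zeroSection ℝ (TangentSpace 𝓘(ℝ, EG) : G → Type _)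
    have h2 : ContMDiff 𝓘(ℝ, EG) 𝓘(ℝ, EG).tangent ∞
        (fun _ : G => (⟨1, ξ⟩ : TangentBundle 𝓘(ℝ, EG) G)) := contMDiff_const
    rw [← contMDiffOn_univ] at h1 h2 ⊢
    refine (ContMDiffOn.mfderiv_partial_left (contMDiff_mul 𝓘(ℝ, EG) ∞) h1 h2).congr fun g _ => ?_
    refine Bundle.TotalSpace.ext (mul_one g).symm (heq_of_eq ?_)
    refine Eq.trans ?_ (congrArg (· + mulInvariantVectorField ξ g)
      (map_zero (mfderiv 𝓘(ℝ, EG) 𝓘(ℝ, EG) (fun z : G => z * 1) g))).symm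
    exact (zero_add _).symm⟩

end LeftInvariant

namespace SmoothPrincipalBundle

variable {EM EG EP : Type*} [NormedAddCommGroup EM] [NormedSpace ℝ EM] [FiniteDimensional ℝ EM]
  [NormedAddCommGroup EG] [NormedSpace ℝ EG] [FiniteDimensional ℝ EG]
  [NormedAddCommGroup EP] [NormedSpace ℝ EP] [FiniteDimensional ℝ EP]
  {M G P : Type*} [TopologicalSpace M] [ChartedSpace EM M] [IsManifold 𝓘(ℝ, EM) ∞ M]
  [TopologicalSpace G] [ChartedSpace EG G] [Group G] [LieGroup 𝓘(ℝ, EG) ∞ G]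
  [TopologicalSpace P] [ChartedSpace EP P] [IsManifold 𝓘(ℝ, EP) ∞ P]
  {B : SmoothPrincipalBundle EM EG EP M G P}

namespace LocalSection

variable (S : B.LocalSection)

/-- The parametrization `g ↦ σ(x).g⁻¹` of the fibre over `x`. -/
def fibre (x : M) (g : G) : P := B.act (S.section' x) g⁻¹

/-- The inverse of the parametrization `fibre`. -/
def coordInv (u : P) : G := (S.coord u)⁻¹

theorem contMDiff_act_inv : ContMDiff (𝓘(ℝ, EP).prod 𝓘(ℝ, EG)) 𝓘(ℝ, EP) ∞
    fun p : P × G => B.act p.1 p.2⁻¹ :=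
  B.contMDiff_act.comp (contMDiff_fst.prodMk ((contMDiff_inv 𝓘(ℝ, EG) ∞).comp contMDiff_snd))

theorem contMDiff_fibre (x : M) : ContMDiff 𝓘(ℝ, EG) 𝓘(ℝ, EP) ∞ (S.fibre x) :=
  B.contMDiff_act.comp (contMDiff_const.prodMk (contMDiff_inv 𝓘(ℝ, EG) ∞))

theorem contMDiffOn_coordInv :
    ContMDiffOn 𝓘(ℝ, EP) 𝓘(ℝ, EG) ∞ S.coordInv (B.proj ⁻¹' S.base) :=
  (contMDiff_inv 𝓘(ℝ, EG) ∞).comp_contMDiffOn S.contMDiffOn_coord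

theorem isOpen_preimage_base : IsOpen (B.proj ⁻¹' S.base) :=
  S.isOpen_base.preimage B.contMDiff_proj.continuous

theorem section_mem {x : M} (hx : x ∈ S.base) : S.section' x ∈ B.proj ⁻¹' S.base := by
  rw [Set.mem_preimage, S.proj_section x hx]
  exact hx

theorem mdifferentiableAt_coordInv {x : M} (hx : x ∈ S.base) :
    MDifferentiableAt 𝓘(ℝ, EP) 𝓘(ℝ, EG) S.coordInv (S.section' x) :=
  (S.contMDiffOn_coordInv.contMDiffAt
    (S.isOpen_preimage_base.mem_nhds (S.section_mem hx))).mdifferentiableAt (by simp)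

theorem coordInv_fibre {x : M} (hx : x ∈ S.base) (g : G) : S.coordInv (S.fibre x g) = g := by
  have h := S.coord_act (S.section' x) g⁻¹ (S.section_mem hx)
  rw [S.coord_section x hx, one_mul] at h
  rw [coordInv, fibre, h, inv_inv]

theorem coordInv_section {x : M} (hx : x ∈ S.base) : S.coordInv (S.section' x) = 1 := by
  rw [coordInv, S.coord_section x hx, inv_one]

theorem fibre_one (x : M) : S.fibre x 1 = S.section' x := by
  rw [fibre, inv_one, B.act_one]

/-- The vertical component at `x` of an invariant vector field. -/
noncomputable def evalAt (x : M) (a : B.atiyahAlgebra) : GroupLieAlgebra 𝓘(ℝ, EG) G :=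
  (mfderiv 𝓘(ℝ, EP) 𝓘(ℝ, EG) S.coordInv (S.section' x) (a.1 (S.section' x)) : EG)

theorem mfderiv_coordInv_fibre {x : M} (hx : x ∈ S.base) (ξ : EG) :
    (mfderiv 𝓘(ℝ, EP) 𝓘(ℝ, EG) S.coordInv (S.section' x)
      (mfderiv 𝓘(ℝ, EG) 𝓘(ℝ, EP) (S.fibre x) 1 ξ : EP) : EG) = ξ := by
  have h1 : MDifferentiableAt 𝓘(ℝ, EG) 𝓘(ℝ, EP) (S.fibre x) 1 :=
    (S.contMDiff_fibre x).mdifferentiableAt (by simp)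
  have h2 := S.mdifferentiableAt_coordInv hx
  rw [← S.fibre_one x] at h2 ⊢
  have h3 := mfderiv_comp _ h2 h1
  have h4 : S.coordInv ∘ S.fibre x = id := funext (S.coordInv_fibre hx)
  rw [h4, mfderiv_id] at h3
  exact (congrArg (fun l => l ξ) h3).symm

/-- Differentiate u = σ(π(u)) · `coordInv`(u)⁻¹ along k. The contribution through π vanishes since k
is vertical. -/
theorem mfderiv_fibre_evalAt {x : M} (hx : x ∈ S.base) {k : B.atiyahAlgebra}
    (hk : k ∈ B.kernelAlgebra) :
    (mfderiv 𝓘(ℝ, EG) 𝓘(ℝ, EP) (S.fibre x) 1 (S.evalAt x k) : EP) = k.1 (S.section' x) := by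
  let u := S.section' x
  have hσ : MDifferentiableAt 𝓘(ℝ, EM) 𝓘(ℝ, EP) S.section' (B.proj u) := by
    have : B.proj u ∈ S.base := S.section_mem hx
    exact (S.contMDiffOn_section.contMDiffAt (S.isOpen_base.mem_nhds this)).mdifferentiableAt
      (by simp)
  have hπ : MDifferentiableAt 𝓘(ℝ, EP) 𝓘(ℝ, EM) B.proj u :=
    B.contMDiff_proj.mdifferentiableAt (by simp)
  have hc := S.mdifferentiableAt_coordInv hx
  have hF : MDifferentiableAt (𝓘(ℝ, EP).prod 𝓘(ℝ, EG)) 𝓘(ℝ, EP)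
      (fun p : P × G => B.act p.1 p.2⁻¹) (S.section' (B.proj u), S.coordInv u) :=
    (contMDiff_act_inv (B := B)).mdifferentiableAt (by simp)
  have h1 := mfderiv_comp u hF ((hσ.comp u hπ).prodMk hc)
  have h2 : (fun p : P × G => B.act p.1 p.2⁻¹) ∘
      (fun v => ((S.section' ∘ B.proj) v, S.coordInv v)) =ᶠ[𝓝 u] id := by
    filter_upwards [S.isOpen_preimage_base.mem_nhds (S.section_mem hx)] with v hv
    simpa [coordInv] using S.act_coord v hv
  rw [h2.mfderiv_eq, mfderiv_id, mfderiv_prodMk (hσ.comp u hπ) hc] at h1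
  have h3 := congrArg (fun l => l (k.1 u)) h1
  refine Eq.trans ?_ h3.symm
  have h4 : mfderiv 𝓘(ℝ, EP) 𝓘(ℝ, EP) (S.section' ∘ B.proj) u (k.1 u) = 0 := by
    rw [mfderiv_comp u hσ hπ]
    refine (congrArg (mfderiv 𝓘(ℝ, EM) 𝓘(ℝ, EP) S.section' (B.proj u))
      (B.anchor_proj k u).symm).trans ?_
    rw [(B.anchor.mem_ker).1 hk]
    exact map_zero _
  refine Eq.trans ?_ (mfderiv_prod_eq_add_apply hF).symm
  have h5 : ∀ (p : P) (g : G) (w : EG), p = S.section' x → g = 1 →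
      (mfderiv 𝓘(ℝ, EG) 𝓘(ℝ, EP) (fun z => B.act p z⁻¹) g w : EP)
        = mfderiv 𝓘(ℝ, EG) 𝓘(ℝ, EP) (S.fibre x) 1 w := by
    rintro _ _ w rfl rfl
    rfl
  have h6 := h5 _ _ (S.evalAt x k) (congrArg S.section' (S.proj_section x hx))
    (S.coordInv_section hx)
  have h7 := (congrArg (mfderiv 𝓘(ℝ, EP) 𝓘(ℝ, EP) (fun z => B.act z (S.coordInv u)⁻¹)
    (S.section' (B.proj u))) h4).trans (map_zero _)
  exact ((congrArg₂ (fun a b : EP => a + b) h7 h6).trans (zero_add _)).symm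

/-- This is why the fibre is parametrized by g ↦ σ(x).g⁻¹: right translation of the fibre by g⁻¹
becomes left multiplication by g. Invariant vertical fields thus correspond to left invariant
fields, and brackets match without a sign. -/
theorem related_fibre {x : M} (hx : x ∈ S.base) {k : B.atiyahAlgebra} (hk : k ∈ B.kernelAlgebra) :
    (leftInvariantField (S.evalAt x k)).Related (S.fibre x) k.1 := by
  intro g
  have h1 : MDifferentiableAt 𝓘(ℝ, EG) 𝓘(ℝ, EP) (S.fibre x) 1 :=
    (S.contMDiff_fibre x).mdifferentiableAt (by simp)
  have h2 : MDifferentiableAt 𝓘(ℝ, EP) 𝓘(ℝ, EP) (fun p => B.act p g⁻¹) (S.fibre x 1) :=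
    (B.contMDiff_act_right g⁻¹).mdifferentiableAt (by simp)
  have h3 : MDifferentiableAt 𝓘(ℝ, EG) 𝓘(ℝ, EG) (fun z : G => g * z) 1 :=
    (contMDiff_mul_left (I := 𝓘(ℝ, EG)) (n := ∞)).mdifferentiableAt (by simp)
  have h4 : MDifferentiableAt 𝓘(ℝ, EG) 𝓘(ℝ, EP) (S.fibre x) (g * 1) :=
    (S.contMDiff_fibre x).mdifferentiableAt (by simp)
  have h5 : (fun p => B.act p g⁻¹) ∘ S.fibre x = S.fibre x ∘ fun z => g * z := by
    funext z
    simp [fibre, B.act_mul]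
  have h6 := mfderiv_comp (1 : G) h2 h1
  have h7 := mfderiv_comp (1 : G) h4 h3
  rw [h5, h7] at h6
  have h8 := congrArg (fun l => l (S.evalAt x k)) h6
  have h9 : ∀ (g' : G) (w : EG), g' = g →
      (mfderiv 𝓘(ℝ, EG) 𝓘(ℝ, EP) (S.fibre x) g' w : EP)
        = mfderiv 𝓘(ℝ, EG) 𝓘(ℝ, EP) (S.fibre x) g w := by
    rintro _ w rfl
    rfl
  refine (h9 (g * 1) _ (mul_one g)).symm.trans (h8.trans ?_)
  have h10 : ∀ (p : P) (w : EP), p = S.section' x →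
      w = k.1 (S.section' x) → (mfderiv 𝓘(ℝ, EP) 𝓘(ℝ, EP) (fun p => B.act p g⁻¹) p w : EP)
        = k.1 (B.act (S.section' x) g⁻¹) := by
    rintro _ _ rfl rfl
    exact k.2 g⁻¹ _
  exact h10 _ _ (S.fibre_one x) (S.mfderiv_fibre_evalAt hx hk)

/-- Evaluation of the kernel of the anchor at a point is a morphism of Lie algebras. -/
noncomputable def evalHom {x : M} (hx : x ∈ S.base) :
    B.kernelAlgebra →ₗ⁅ℝ⁆ GroupLieAlgebra 𝓘(ℝ, EG) G where
  toFun k := S.evalAt x k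
  map_add' k l := map_add (mfderiv 𝓘(ℝ, EP) 𝓘(ℝ, EG) S.coordInv (S.section' x)) _ _
  map_smul' c k := map_smul (mfderiv 𝓘(ℝ, EP) 𝓘(ℝ, EG) S.coordInv (S.section' x)) c _
  map_lie' {k l} := by
    have h1 := (S.related_fibre hx k.2).lie (S.contMDiff_fibre x) (S.related_fibre hx l.2) 1
    have h2 : (⁅k.1.1, l.1.1⁆ (S.fibre x 1) : EP) = ⁅k.1.1, l.1.1⁆ (S.section' x) := by
      rw [S.fibre_one]
    refine Eq.trans ?_ (S.mfderiv_coordInv_fibre hx _)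
    exact congrArg (mfderiv 𝓘(ℝ, EP) 𝓘(ℝ, EG) S.coordInv (S.section' x)) (h1.trans h2).symm

theorem evalHom_apply {x : M} (hx : x ∈ S.base) (k : B.kernelAlgebra) :
    S.evalHom hx k = S.evalAt x k := rfl

theorem evalHom_smul {x : M} (hx : x ∈ S.base) (f : C^∞⟮𝓘(ℝ, EM), M; ℝ⟯) (k : B.kernelAlgebra) :
    S.evalHom hx (f • k) = f x • S.evalHom hx k := by
  have h : ((f • k.1).1 (S.section' x) : EP) = f x • k.1.1 (S.section' x) := by
    rw [smul_apply, S.proj_section x hx]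
  exact (congrArg (mfderiv 𝓘(ℝ, EP) 𝓘(ℝ, EG) S.coordInv (S.section' x)) h).trans
    (map_smul (mfderiv 𝓘(ℝ, EP) 𝓘(ℝ, EG) S.coordInv (S.section' x)) _ _)

theorem evalHom_eq_zero_iff {x : M} (hx : x ∈ S.base) (k : B.kernelAlgebra) :
    S.evalHom hx k = 0 ↔ k ∈ B.kernelVanishingAt x := by
  constructor
  · intro h u hu
    have h1 : (k.1.1 (S.section' x) : EP) = 0 := by
      rw [← S.mfderiv_fibre_evalAt hx k.2, ← S.evalHom_apply hx, h]
      exact map_zero _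
    obtain ⟨g, rfl⟩ := B.exists_act_eq ((S.proj_section x hx).trans hu.symm)
    exact (k.1.2 g _).symm.trans
      ((congrArg (mfderiv 𝓘(ℝ, EP) 𝓘(ℝ, EP) (fun u => B.act u g) _) h1).trans (map_zero _))
  · intro h
    exact (congrArg (mfderiv 𝓘(ℝ, EP) 𝓘(ℝ, EG) S.coordInv (S.section' x))
      (h _ (S.proj_section x hx))).trans (map_zero _)

theorem kernel_ext {k l : B.kernelAlgebra} (h : ∀ x (hx : x ∈ S.base), S.evalHom hx k = S.evalHom hx l)
    (h' : ∀ u, B.proj u ∉ S.base → k.1.1 u = l.1.1 u) : k = l := by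
  refine Subtype.ext (B.atiyah_ext fun u => ?_)
  by_cases hu : B.proj u ∈ S.base
  · have := (S.evalHom_eq_zero_iff hu (k - l)).1 (by rw [map_sub, h _ hu, sub_self]) u rfl
    exact sub_eq_zero.1 this
  · exact h' u hu

theorem contMDiffOn_evalAt (a : B.atiyahAlgebra) :
    ContMDiffOn 𝓘(ℝ, EM) 𝓘(ℝ, EG) ∞ (M' := EG) (fun x => S.evalAt x a) S.base := by
  intro x hx
  have h1 : ContMDiffOn 𝓘(ℝ, EP).tangent 𝓘(ℝ, EG).tangent ∞
      (tangentMapWithin 𝓘(ℝ, EP) 𝓘(ℝ, EG) S.coordInv (B.proj ⁻¹' S.base)) _ :=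
    S.contMDiffOn_coordInv.contMDiffOn_tangentMapWithin (by rfl)
      S.isOpen_preimage_base.uniqueMDiffOn
  have h2 := h1.comp (a.1.contMDiff.comp_contMDiffOn S.contMDiffOn_section)
    (fun y hy => S.section_mem hy)
  have h3 : ContMDiffOn 𝓘(ℝ, EM) 𝓘(ℝ, EG).tangent ∞
      (fun y => (⟨1, S.evalAt y a⟩ : TangentBundle 𝓘(ℝ, EG) G)) S.base := by
    refine h2.congr fun y hy => ?_
    refine Bundle.TotalSpace.ext (S.coordInv_section hy).symm (heq_of_eq ?_)
    have := mfderivWithin_of_isOpen (I := 𝓘(ℝ, EP)) (I' := 𝓘(ℝ, EG)) (f := S.coordInv)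
      S.isOpen_preimage_base (S.section_mem hy)
    exact (congrArg (fun l => l (a.1 (S.section' y))) this).symm
  have h4 := (Bundle.contMDiffWithinAt_totalSpace.1 (h3 x hx)).2
  -- The trivialization of TG centred at 1 is the identity on the fibre over 1, so smoothness of the
  -- lift is smoothness of its vector part.
  have h5 : ∀ v : EG, (trivializationAt EG (TangentSpace 𝓘(ℝ, EG) : G → Type _) 1
      (⟨1, v⟩ : TangentBundle 𝓘(ℝ, EG) G)).2 = v := fun v =>
    congrArg Prod.snd ((tangentBundleCore 𝓘(ℝ, EG) G).localTrivAt_apply_mk 1 v)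
  exact h4.congr (fun y _ => (h5 _).symm) (h5 _).symm

/-- The invariant vertical vector field with vertical component `χ • ξ` along the section. -/
theorem exists_evalHom_eq {χ : C^∞⟮𝓘(ℝ, EM), M; ℝ⟯} (hχ : tsupport χ ⊆ S.base)
    (ξ : GroupLieAlgebra 𝓘(ℝ, EG) G) : ∃ k : B.kernelAlgebra,
      (∀ x (hx : x ∈ S.base), S.evalHom hx k = χ x • ξ) ∧
      ∀ u, χ (B.proj u) = 0 → k.1.1 u = 0 := by
  let Y : M → EP := fun x => mfderiv 𝓘(ℝ, EG) 𝓘(ℝ, EP) (S.fibre x) 1 ξ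
  have hY : ContMDiffOn 𝓘(ℝ, EM) 𝓘(ℝ, EP).tangent ∞
      (fun x => (⟨S.section' x, Y x⟩ : TangentBundle 𝓘(ℝ, EP) P)) S.base := by
    have h1 : ContMDiffOn 𝓘(ℝ, EM) 𝓘(ℝ, EP).tangent ∞
        (fun x => (⟨S.section' x, 0⟩ : TangentBundle 𝓘(ℝ, EP) P)) S.base :=
      (Bundle.contMDiff_zeroSection ℝ (TangentSpace 𝓘(ℝ, EP) : P → Type _)).comp_contMDiffOn
        S.contMDiffOn_section
    have h2 : ContMDiffOn 𝓘(ℝ, EM) 𝓘(ℝ, EG).tangent ∞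
        (fun _ => (⟨1, ξ⟩ : TangentBundle 𝓘(ℝ, EG) G)) S.base := contMDiffOn_const
    refine (ContMDiffOn.mfderiv_partial_left (contMDiff_act_inv (B := B)) h1 h2).congr
      fun x _ => ?_
    refine Bundle.TotalSpace.ext (S.fibre_one x).symm (heq_of_eq ?_)
    refine Eq.trans ?_ (congrArg (· + Y x)
      (map_zero (mfderiv 𝓘(ℝ, EP) 𝓘(ℝ, EP) (fun z => B.act z (1 : G)⁻¹) (S.section' x)))).symm
    exact (zero_add _).symm
  let a := S.extend χ S.isOpen_base subset_rfl hχ hY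
  have ha : ∀ x ∈ S.base, (a.1 (S.section' x) : EP) = χ x • Y x := fun x hx =>
    S.extend_section χ S.isOpen_base subset_rfl hχ hY hx
  have ha0 : ∀ u, χ (B.proj u) = 0 → a.1 u = 0 := fun u hu =>
    S.extend_eq_zero χ S.isOpen_base subset_rfl hχ hY hu
  have hk : a ∈ B.kernelAlgebra := by
    rw [LieHom.mem_ker]
    ext x
    by_cases hx : x ∈ S.base
    · have h1 := B.anchor_proj a (S.section' x)
      rw [S.proj_section x hx] at h1
      have h2 : (mfderiv 𝓘(ℝ, EP) 𝓘(ℝ, EM) B.proj (S.section' x) (Y x) : EM) = 0 := by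
        have h3 : MDifferentiableAt 𝓘(ℝ, EG) 𝓘(ℝ, EP) (S.fibre x) 1 :=
          (S.contMDiff_fibre x).mdifferentiableAt (by simp)
        have h4 := mfderiv_comp (1 : G) (B.contMDiff_proj.mdifferentiableAt (by simp)) h3
        have h5 : B.proj ∘ S.fibre x = fun _ => x := funext fun g => by
          simp [fibre, B.proj_act, S.proj_section x hx]
        rw [h5, mfderiv_const, S.fibre_one] at h4
        exact (congrArg (fun l => l ξ) h4).symm
      refine h1.trans ((congrArg (mfderiv 𝓘(ℝ, EP) 𝓘(ℝ, EM) B.proj (S.section' x)) (ha x hx)).trans ?_)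
      refine (map_smul (mfderiv 𝓘(ℝ, EP) 𝓘(ℝ, EM) B.proj (S.section' x)) _ _).trans ?_
      exact (congrArg (χ x • ·) h2).trans (smul_zero _)
    · obtain ⟨u, rfl⟩ := B.proj_surjective x
      rw [B.anchor_proj, ha0 u]
      · exact map_zero _
      · by_contra h
        exact hx (hχ (subset_tsupport _ h))
  refine ⟨⟨a, hk⟩, fun x hx => ?_, ha0⟩
  refine (congrArg (mfderiv 𝓘(ℝ, EP) 𝓘(ℝ, EG) S.coordInv (S.section' x)) (ha x hx)).trans ?_
  refine (map_smul (mfderiv 𝓘(ℝ, EP) 𝓘(ℝ, EG) S.coordInv (S.section' x)) _ _).trans ?_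
  exact congrArg (χ x • ·) (S.mfderiv_coordInv_fibre hx ξ)

end LocalSection
end SmoothPrincipalBundle

/-! ### Local frames of vertical fields and local perfectness of the kernel. -/

theorem exists_smooth_mul_of_contMDiffOn {E : Type*} [NormedAddCommGroup E] [NormedSpace ℝ E]
    {M : Type*} [TopologicalSpace M] [ChartedSpace E M] {U : Set M} (hU : IsOpen U)
    {χ : C^∞⟮𝓘(ℝ, E), M; ℝ⟯} (hχ : tsupport χ ⊆ U) {F : M → ℝ}
    (hF : ContMDiffOn 𝓘(ℝ, E) 𝓘(ℝ, ℝ) ∞ F U) :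
    ∃ c : C^∞⟮𝓘(ℝ, E), M; ℝ⟯, ∀ x, c x = χ x * F x :=
  ⟨⟨fun x => χ x * F x, contMDiff_of_tsupport fun x hx => by
    have hx' : x ∈ U := hχ (tsupport_mul_subset_left hx)
    exact (χ.contMDiff x).mul (hF.contMDiffAt (hU.mem_nhds hx'))⟩, fun _ => rfl⟩

namespace SmoothPrincipalBundle

variable {EM EG EP : Type*} [NormedAddCommGroup EM] [NormedSpace ℝ EM] [FiniteDimensional ℝ EM]
  [NormedAddCommGroup EG] [NormedSpace ℝ EG] [FiniteDimensional ℝ EG]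
  [NormedAddCommGroup EP] [NormedSpace ℝ EP] [FiniteDimensional ℝ EP]
  {M G P : Type*} [TopologicalSpace M] [ChartedSpace EM M] [IsManifold 𝓘(ℝ, EM) ∞ M]
  [TopologicalSpace G] [ChartedSpace EG G] [Group G] [LieGroup 𝓘(ℝ, EG) ∞ G]
  [TopologicalSpace P] [ChartedSpace EP P] [IsManifold 𝓘(ℝ, EP) ∞ P]
  {B : SmoothPrincipalBundle EM EG EP M G P}

theorem smul_kernel_apply_eq_zero {f : C^∞⟮𝓘(ℝ, EM), M; ℝ⟯} (k : B.kernelAlgebra) {u : P}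
    (h : f (B.proj u) = 0) : (f • k).1.1 u = 0 :=
  (congrArg (· • k.1.1 u) h).trans (zero_smul ℝ _)

namespace LocalSection

variable (S : B.LocalSection) {χ : C^∞⟮𝓘(ℝ, EM), M; ℝ⟯} (hχ : tsupport χ ⊆ S.base)

include hχ in
theorem eq_zero_of_notMem_base {x : M} (hx : x ∉ S.base) : χ x = 0 := by
  by_contra h
  exact hx (hχ (subset_tsupport _ h))

/-- The invariant vertical vector field with vertical component `χ • ξ` along the section. -/
noncomputable def vertical : GroupLieAlgebra 𝓘(ℝ, EG) G →ₗ[ℝ] B.kernelAlgebra where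
  toFun ξ := (S.exists_evalHom_eq hχ ξ).choose
  map_add' ξ η := by
    have h1 := (S.exists_evalHom_eq hχ (ξ + η)).choose_spec
    have h2 := (S.exists_evalHom_eq hχ ξ).choose_spec
    have h3 := (S.exists_evalHom_eq hχ η).choose_spec
    refine S.kernel_ext (fun x hx => ?_) fun u hu => ?_
    · rw [map_add, h1.1 x hx, h2.1 x hx, h3.1 x hx, smul_add]
    · have h0 := S.eq_zero_of_notMem_base hχ hu
      rw [h1.2 u h0]
      exact ((congrArg₂ (· + ·) (h2.2 u h0) (h3.2 u h0)).trans (add_zero _)).symm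
  map_smul' c ξ := by
    have h1 := (S.exists_evalHom_eq hχ (c • ξ)).choose_spec
    have h2 := (S.exists_evalHom_eq hχ ξ).choose_spec
    refine S.kernel_ext (fun x hx => ?_) fun u hu => ?_
    · rw [map_smul, h1.1 x hx, h2.1 x hx, RingHom.id_apply, smul_comm]
    · have h0 := S.eq_zero_of_notMem_base hχ hu
      rw [h1.2 u h0]
      exact ((congrArg (c • ·) (h2.2 u h0)).trans (smul_zero _)).symm

theorem evalHom_vertical (ξ : GroupLieAlgebra 𝓘(ℝ, EG) G) {x : M} (hx : x ∈ S.base) :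
    S.evalHom hx (S.vertical hχ ξ) = χ x • ξ :=
  (S.exists_evalHom_eq hχ ξ).choose_spec.1 x hx

theorem vertical_apply_eq_zero (ξ : GroupLieAlgebra 𝓘(ℝ, EG) G) {u : P} (hu : χ (B.proj u) = 0) :
    (S.vertical hχ ξ).1.1 u = 0 :=
  (S.exists_evalHom_eq hχ ξ).choose_spec.2 u hu

theorem lie_vertical (ξ η : GroupLieAlgebra 𝓘(ℝ, EG) G) :
    ⁅S.vertical hχ ξ, S.vertical hχ η⁆ = χ • S.vertical hχ ⁅ξ, η⁆ := by
  refine S.kernel_ext (fun x hx => ?_) fun u hu => ?_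
  · rw [LieHom.map_lie, evalHom_smul, evalHom_vertical, evalHom_vertical, evalHom_vertical,
      smul_lie, lie_smul]
  · have h0 := S.eq_zero_of_notMem_base hχ hu
    rw [smul_kernel_apply_eq_zero _ h0]
    change VectorField.mlieBracket 𝓘(ℝ, EP) _ _ u = 0
    rw [← VectorField.mlieBracketWithin_univ]
    exact VectorField.mlieBracketWithin_eq_zero_of_eq_zero (S.vertical_apply_eq_zero hχ ξ h0)
      (S.vertical_apply_eq_zero hχ η h0)

/-- The kernel of the anchor is locally spanned by vertical fields. -/
theorem exists_sq_smul_eq_sum {ι : Type*} [Fintype ι]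
    (b : Module.Basis ι ℝ (GroupLieAlgebra 𝓘(ℝ, EG) G)) (k : B.kernelAlgebra) :
    ∃ c : ι → C^∞⟮𝓘(ℝ, EM), M; ℝ⟯, χ ^ 2 • k = ∑ i, c i • S.vertical hχ (b i) ∧
      ∀ x ∈ S.base, k ∈ B.kernelVanishingAt x → ∀ i, c i x = 0 := by
  let l : ι → EG →L[ℝ] ℝ := fun i => LinearMap.toContinuousLinearMap (E := EG) (b.coord i)
  have hl : ∀ i, ContMDiffOn 𝓘(ℝ, EM) 𝓘(ℝ, ℝ) ∞ (fun x => l i (S.evalAt x k.1)) S.base :=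
    fun i => (l i).contMDiff.comp_contMDiffOn (S.contMDiffOn_evalAt k.1)
  -- One factor χ makes the coordinate functions of k global; the other is contained in the vertical
  -- fields. Hence the square.
  choose c hc using fun i => exists_smooth_mul_of_contMDiffOn S.isOpen_base hχ (hl i)
  refine ⟨c, S.kernel_ext (fun x hx => ?_) fun u hu => ?_, fun x hx hk i => ?_⟩
  · rw [map_sum, evalHom_smul]
    have h1 : ∀ i, S.evalHom hx (c i • S.vertical hχ (b i))
        = χ x ^ 2 • (l i (S.evalAt x k.1) • b i) := fun i => by
      rw [evalHom_smul, evalHom_vertical, hc, smul_smul]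
      refine Eq.trans ?_ (smul_smul (χ x ^ 2) (l i (S.evalAt x k.1)) (b i)).symm
      congr 1
      ring
    rw [Finset.sum_congr rfl fun i _ => h1 i]
    refine Eq.trans ?_ (Finset.smul_sum (r := χ x ^ 2)
      (f := fun i => (l i (S.evalAt x k.1) • b i)) (s := Finset.univ))
    exact congrArg (χ x ^ 2 • ·) (b.sum_repr (S.evalAt x k.1)).symm
  · have h0 := S.eq_zero_of_notMem_base hχ hu
    have h1 : (χ ^ 2) (B.proj u) = 0 := by
      change (χ (B.proj u)) ^ 2 = 0
      rw [h0, zero_pow two_ne_zero]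
    rw [smul_kernel_apply_eq_zero k h1]
    let ev : B.kernelAlgebra →+ TangentSpace 𝓘(ℝ, EP) u :=
      { toFun := fun k => k.1.1 u
        map_zero' := rfl
        map_add' := fun _ _ => rfl }
    have h2 : ev (∑ i, c i • S.vertical hχ (b i)) = 0 := by
      rw [map_sum]
      refine Finset.sum_eq_zero fun i _ => smul_kernel_apply_eq_zero _ ?_
      rw [hc, h0, zero_mul]
    exact h2.symm
  · rw [hc]
    have h1 : (S.evalAt x k.1 : EG) = 0 := (S.evalHom_eq_zero_iff hx k).2 hk
    rw [h1]
    exact (congrArg (χ x * ·) (map_zero (l i))).trans (mul_zero _)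

include S hχ in
/-- If the structure group is semisimple, then the kernel of the anchor is perfect near every
point. -/
theorem cube_mem_multiplierIdeal [LieAlgebra.IsSemisimple ℝ (GroupLieAlgebra 𝓘(ℝ, EG) G)]
    {J : Submodule ℝ B.kernelAlgebra} (hJ : ∀ k l : B.kernelAlgebra, ⁅k, l⁆ ∈ J) :
    χ ^ 3 ∈ multiplierIdeal C^∞⟮𝓘(ℝ, EM), M; ℝ⟯ J := by
  -- Since 𝔤 = [𝔤, 𝔤], it suffices to treat ξ = [η, ζ], for which the element is the bracket of the
  -- vertical field of η with f times that of ζ. This costs one further factor χ beyond the χ² of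
  -- the frame expansion.
  have key : ∀ (f : C^∞⟮𝓘(ℝ, EM), M; ℝ⟯) (ξ : GroupLieAlgebra 𝓘(ℝ, EG) G),
      f • χ • S.vertical hχ ξ ∈ J := by
    intro f ξ
    have hξ : ξ ∈ (⁅(⊤ : LieIdeal ℝ (GroupLieAlgebra 𝓘(ℝ, EG) G)),
        (⊤ : LieIdeal ℝ (GroupLieAlgebra 𝓘(ℝ, EG) G))⁆).toSubmodule := by
      rw [LieIdeal.lie_self_eq_of_isSemisimple]
      trivial
    rw [LieSubmodule.lieIdeal_oper_eq_linear_span'] at hξ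
    induction hξ using Submodule.span_induction with
    | mem ξ h =>
      obtain ⟨η, -, ζ, -, rfl⟩ := h
      rw [← lie_vertical, ← lie_smul_kernel]
      exact hJ _ _
    | zero => simp
    | add ξ η _ _ h1 h2 =>
      rw [map_add, smul_add, smul_add]
      exact J.add_mem h1 h2
    | smul c ξ _ h =>
      have h1 : f • χ • S.vertical hχ (c • ξ) = c • f • χ • S.vertical hχ ξ := by
        rw [map_smul, smul_algebra_smul_comm c χ, smul_algebra_smul_comm c f]
      rw [h1]
      exact J.smul_mem c h
  rw [mem_multiplierIdeal]
  intro k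
  obtain ⟨c, hc, -⟩ := S.exists_sq_smul_eq_sum hχ (Module.finBasis ℝ EG) k
  rw [pow_succ', mul_smul, hc, Finset.smul_sum]
  refine J.sum_mem fun i _ => ?_
  rw [smul_comm]
  exact key _ _

end LocalSection
end SmoothPrincipalBundle

/-! ### Isotropy subalgebras: maximality and classification. -/

theorem exists_smooth_mvfderiv_eq_one {E : Type*} [NormedAddCommGroup E] [NormedSpace ℝ E]
    [FiniteDimensional ℝ E] {M : Type*} [TopologicalSpace M] [ChartedSpace E M]
    [IsManifold 𝓘(ℝ, E) ∞ M] [T2Space M] {m : M} {v : TangentSpace 𝓘(ℝ, E) m} (hv : v ≠ 0) :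
    ∃ f : C^∞⟮𝓘(ℝ, E), M; ℝ⟯, f m = 0 ∧ mvfderiv 𝓘(ℝ, E) f m v = 1 := by
  let φ := extChartAt 𝓘(ℝ, E) m
  have hm : m ∈ φ.source := mem_extChartAt_source m
  have hopen : IsOpen φ.source := isOpen_extChartAt_source m
  have hinv := isInvertible_mfderiv_extChartAt (I := 𝓘(ℝ, E)) hm
  have hne : (mfderiv 𝓘(ℝ, E) 𝓘(ℝ, E) φ m v : E) ≠ 0 := fun h =>
    hv (hinv.injective (h.trans (map_zero (mfderiv 𝓘(ℝ, E) 𝓘(ℝ, E) φ m)).symm))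
  have hdual : ∀ w : E, w ≠ 0 → ∃ l : E →L[ℝ] ℝ, l w = 1 := fun w hw =>
    SeparatingDual.exists_eq_one hw
  obtain ⟨l, hl⟩ := hdual _ hne
  obtain ⟨χ, -, hχ⟩ := (SmoothBumpFunction.nhds_basis_tsupport (I := 𝓘(ℝ, E)) m).mem_iff.1
    (hopen.mem_nhds hm)
  let g : E → ℝ := fun y => l (y - φ m)
  have hg : ContDiff ℝ ∞ g := l.contDiff.comp (contDiff_id.sub contDiff_const)
  have hg' : HasFDerivAt g l (φ m) :=
    l.hasFDerivAt.comp (φ m) ((hasFDerivAt_id (φ m)).sub_const (φ m))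
  have hφ : ContMDiffOn 𝓘(ℝ, E) 𝓘(ℝ, E) ∞ φ φ.source := by
    have h := contMDiffOn_extChartAt (I := 𝓘(ℝ, E)) (x := m) (n := ∞)
    rwa [← extChartAt_source 𝓘(ℝ, E)] at h
  obtain ⟨c, hc⟩ := exists_smooth_mul_of_contMDiffOn (χ := ⟨χ, χ.contMDiff⟩) hopen hχ
    (hg.contMDiff.comp_contMDiffOn hφ)
  refine ⟨c, ?_, ?_⟩
  · rw [hc]
    simp [g]
  · have h1 : c =ᶠ[𝓝 m] g ∘ φ := by
      filter_upwards [χ.eventuallyEq_one] with x hx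
      rw [hc]
      change χ x * _ = _
      rw [hx, Pi.one_apply, one_mul]
    have h2 : MDifferentiableAt 𝓘(ℝ, E) 𝓘(ℝ, E) φ m :=
      (hφ.contMDiffAt (hopen.mem_nhds hm)).mdifferentiableAt (by simp)
    have h3 := (hg'.hasMFDerivAt.comp m h2.hasMFDerivAt).congr_of_eventuallyEq h1
    exact (congrArg (fun l => l v) h3.mfderiv).trans hl

namespace SmoothPrincipalBundle

variable {EM EG EP : Type*} [NormedAddCommGroup EM] [NormedSpace ℝ EM] [FiniteDimensional ℝ EM]
  [NormedAddCommGroup EG] [NormedSpace ℝ EG]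
  [NormedAddCommGroup EP] [NormedSpace ℝ EP] [FiniteDimensional ℝ EP]
  {M G P : Type*} [TopologicalSpace M] [ChartedSpace EM M] [IsManifold 𝓘(ℝ, EM) ∞ M]
  [TopologicalSpace G] [ChartedSpace EG G] [Group G] [LieGroup 𝓘(ℝ, EG) ∞ G]
  [TopologicalSpace P] [ChartedSpace EP P] [IsManifold 𝓘(ℝ, EP) ∞ P]
  (B : SmoothPrincipalBundle EM EG EP M G P)

theorem mem_isotropySubalgebra {m : M} {a : B.atiyahAlgebra} :
    a ∈ B.isotropySubalgebra m ↔ B.anchor a m = 0 := Iff.rfl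

theorem cofg_isotropySubalgebra (m : M) : (B.isotropySubalgebra m).toSubmodule.CoFG := by
  let ev : B.atiyahAlgebra →ₗ[ℝ] EM :=
    { toFun := fun a => B.anchor a m
      map_add' := fun a b => by rw [map_add]; rfl
      map_smul' := fun c a => by rw [map_smul]; rfl }
  have h : (B.isotropySubalgebra m).toSubmodule = LinearMap.ker ev := by
    ext a
    exact (LinearMap.mem_ker (f := ev)).symm
  rw [h]
  exact Submodule.CoFG.ker ev

variable [T2Space M]

theorem isotropySubalgebra_ne_top (hM : 0 < Module.finrank ℝ EM) (m : M) :
    B.isotropySubalgebra m ≠ ⊤ := by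
  intro h
  have : Nontrivial EM := Module.nontrivial_of_finrank_pos hM
  obtain ⟨w, hw⟩ := exists_ne (0 : EM)
  obtain ⟨a, ha⟩ := B.exists_anchor_eq m w
  have h1 : a ∈ B.isotropySubalgebra m := h ▸ LieSubalgebra.mem_top a
  exact hw (ha.symm.trans (B.mem_isotropySubalgebra.1 h1))

/-- Take a ∈ T outside 𝒜_m and f with f(m) = 0 and a(f)(m) = 1. For every c, f • c lies in 𝒜_m, and
[a, f • c] agrees with c modulo 𝒜_m; hence c ∈ T. -/
theorem eq_top_of_isotropySubalgebra_lt {m : M} {T : LieSubalgebra ℝ B.atiyahAlgebra}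
    (h : B.isotropySubalgebra m < T) : T = ⊤ := by
  obtain ⟨hle, a, haT, ha⟩ := SetLike.lt_iff_le_and_exists.1 h
  obtain ⟨f, hf, hf'⟩ := exists_smooth_mvfderiv_eq_one (fun h0 => ha (B.mem_isotropySubalgebra.2 h0))
  rw [eq_top_iff]
  intro c _
  have h1 : f • c ∈ B.isotropySubalgebra m := by
    rw [mem_isotropySubalgebra, anchor_smul, hf, zero_smul]
  have h2 : ⁅a, f • c⁆ ∈ T := T.lie_mem haT (hle h1)
  have h3 : c - ⁅a, f • c⁆ ∈ B.isotropySubalgebra m := by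
    rw [mem_isotropySubalgebra, lie_smul_eq, map_sub, map_add]
    have e1 : B.anchor (f • ⁅a, c⁆) m = 0 := by rw [anchor_smul, hf, zero_smul]
    have e2 : B.anchor (B.anchorDerivation a f • c) m = B.anchor c m := by
      rw [anchor_smul, anchorDerivation_apply, hf', one_smul]
    change B.anchor c m - (B.anchor (f • ⁅a, c⁆) m + B.anchor (B.anchorDerivation a f • c) m) = 0
    rw [e1, e2, zero_add, sub_self]
  simpa using T.add_mem (hle h3) h2

theorem isMaximalFiniteCodim_isotropySubalgebra (hM : 0 < Module.finrank ℝ EM) (m : M) :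
    (B.isotropySubalgebra m).IsMaximalFiniteCodim :=
  ⟨B.isotropySubalgebra_ne_top hM m, B.cofg_isotropySubalgebra m,
    fun _ hT _ hlt => hT (B.eq_top_of_isotropySubalgebra_lt hlt)⟩

theorem eq_of_isotropySubalgebra_le (hM : 0 < Module.finrank ℝ EM) {m m' : M}
    (h : B.isotropySubalgebra m ≤ B.isotropySubalgebra m') : m' = m := by
  by_contra hne
  have : Nontrivial EM := Module.nontrivial_of_finrank_pos hM
  obtain ⟨w, hw⟩ := exists_ne (0 : EM)
  obtain ⟨a, ha⟩ := B.exists_anchor_eq m' w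
  obtain ⟨f, hf, hfs⟩ := exists_smooth_bump (EM := EM) (isOpen_compl_singleton (x := m)) hne
  have hfm : f m = 0 := by
    by_contra h0
    exact hfs (subset_tsupport _ h0) rfl
  have h1 : f • a ∈ B.isotropySubalgebra m := by
    rw [mem_isotropySubalgebra, anchor_smul, hfm, zero_smul]
  have h2 := B.mem_isotropySubalgebra.1 (h h1)
  rw [anchor_smul, hf, one_smul, ha] at h2
  exact hw h2

theorem mem_isotropySubalgebra_of_derivation_mem {J : Ideal C^∞⟮𝓘(ℝ, EM), M; ℝ⟯}
    (hJ : J.IsCoalgebraic) {x : M} (hx : ∀ f ∈ J, f x = 0) {a : B.atiyahAlgebra}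
    (ha : ∀ f ∈ J, B.anchorDerivation a f ∈ J) : a ∈ B.isotropySubalgebra x := by
  by_contra h
  obtain ⟨f, -, hf⟩ := exists_smooth_mvfderiv_eq_one (fun h0 => h (B.mem_isotropySubalgebra.2 h0))
  have h1 := eval_derivation_eq_zero hJ _ ha (evalSmooth x) hx f
  rw [evalSmooth_apply, anchorDerivation_apply, hf] at h1
  exact one_ne_zero h1

/-- The multiplier ideal of T is coalgebraic, proper and preserved by T, so the fields in T project
to zero at any of its zeros. -/
theorem exists_le_isotropySubalgebra [SecondCountableTopology M]
    (hM : 0 < Module.finrank ℝ EM) {T : LieSubalgebra ℝ B.atiyahAlgebra} (hT : T ≠ ⊤)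
    (hT' : T.toSubmodule.CoFG) : ∃ x, T ≤ B.isotropySubalgebra x := by
  have : LocallyCompactSpace M := ChartedSpace.locallyCompactSpace EM M
  obtain ⟨a, h, hu⟩ := B.exists_isUnit_sum_sq hM
  have hJ := isCoalgebraic_multiplierIdeal B.anchorDerivation B.lie_smul_eq hT' a h hu
  obtain ⟨x, hx⟩ := exists_forall_mem_eq_zero hJ fun htop => by
    refine hT (eq_top_iff.2 fun c _ => ?_)
    have h1 : (1 : C^∞⟮𝓘(ℝ, EM), M; ℝ⟯) ∈ multiplierIdeal C^∞⟮𝓘(ℝ, EM), M; ℝ⟯ T.toSubmodule :=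
      htop ▸ Submodule.mem_top
    simpa using mem_multiplierIdeal.1 h1 c
  exact ⟨x, fun c hc => B.mem_isotropySubalgebra_of_derivation_mem hJ hx fun f hf =>
    derivation_mem_multiplierIdeal B.anchorDerivation B.lie_smul_eq hc hf⟩

end SmoothPrincipalBundle

/-! ### Maximal ideals of the kernel normalized by an isotropy subalgebra. -/

theorem LieIdeal.isMaximalFiniteCodim_comap {K g : Type*} [LieRing K] [LieAlgebra ℝ K] [LieRing g]
    [LieAlgebra ℝ g] [FiniteDimensional ℝ g] {ev : K →ₗ⁅ℝ⁆ g} (hev : Function.Surjective ev)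
    {I : LieIdeal ℝ g} (hI : IsCoatom I) : (I.comap ev).IsMaximalFiniteCodim := by
  refine ⟨fun h => hI.1 ?_, ?_, fun J hJ _ hlt => hJ ?_⟩
  · rw [eq_top_iff]
    intro y _
    obtain ⟨k, rfl⟩ := hev y
    have : k ∈ I.comap ev := h ▸ LieSubmodule.mem_top k
    exact LieIdeal.mem_comap.1 this
  · have hI' : I.toSubmodule.CoFG := inferInstanceAs (Module.Finite ℝ (g ⧸ I.toSubmodule))
    exact hI'.comap_linearMap (ev : K →ₗ[ℝ] g)
  · have hmap : ((LieIdeal.map ev J : LieIdeal ℝ g) : Set g) = ev '' J :=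
      congrArg (fun S : Submodule ℝ g => (S : Set g)) (LieIdeal.coe_map_of_surjective hev)
    have hmem : ∀ k, ev k ∈ LieIdeal.map ev J → k ∈ J := fun k hk => by
      have hk' : ev k ∈ ev '' (J : Set K) := hmap ▸ hk
      obtain ⟨l, hl, hlk⟩ := hk'
      have : k - l ∈ I.comap ev := by
        rw [LieIdeal.mem_comap, map_sub, hlk, sub_self]
        exact I.zero_mem
      simpa using J.add_mem (hlt.le this) hl
    have hle : I ≤ LieIdeal.map ev J := fun y hy => by
      obtain ⟨k, rfl⟩ := hev y
      exact LieIdeal.mem_map (hlt.le (LieIdeal.mem_comap.2 hy))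
    rcases hI.le_iff.1 hle with h | h
    · rw [eq_top_iff]
      exact fun k _ => hmem k (h ▸ LieSubmodule.mem_top _)
    · exact absurd (fun k hk => LieIdeal.mem_comap.2 (h ▸ LieIdeal.mem_map hk)) hlt.not_ge

namespace SmoothPrincipalBundle

variable {EM EG EP : Type*} [NormedAddCommGroup EM] [NormedSpace ℝ EM] [FiniteDimensional ℝ EM]
  [NormedAddCommGroup EG] [NormedSpace ℝ EG] [FiniteDimensional ℝ EG]
  [NormedAddCommGroup EP] [NormedSpace ℝ EP] [FiniteDimensional ℝ EP]
  {M G P : Type*} [TopologicalSpace M] [ChartedSpace EM M] [IsManifold 𝓘(ℝ, EM) ∞ M]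
  [TopologicalSpace G] [ChartedSpace EG G] [Group G] [LieGroup 𝓘(ℝ, EG) ∞ G]
  [TopologicalSpace P] [ChartedSpace EP P] [IsManifold 𝓘(ℝ, EP) ∞ P]
  (B : SmoothPrincipalBundle EM EG EP M G P)

theorem lie_smul_kernel_of_atiyah (a : B.atiyahAlgebra) (f : C^∞⟮𝓘(ℝ, EM), M; ℝ⟯)
    (k : B.kernelAlgebra) : ⁅a, f • k⁆ = f • ⁅a, k⁆ + B.anchorDerivation a f • k :=
  Subtype.ext (B.lie_smul_eq a f k.1)

theorem anchorDerivation_apply_eq_zero {a : B.atiyahAlgebra} {m : M}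
    (ha : a ∈ B.isotropySubalgebra m) (f : C^∞⟮𝓘(ℝ, EM), M; ℝ⟯) : B.anchorDerivation a f m = 0 := by
  rw [anchorDerivation_apply, B.mem_isotropySubalgebra.1 ha]
  exact map_zero _

variable [T2Space M]

theorem exists_cutoff (m : M) : ∃ (S : B.LocalSection) (χ : C^∞⟮𝓘(ℝ, EM), M; ℝ⟯),
    m ∈ S.base ∧ tsupport χ ⊆ S.base ∧ χ m = 1 := by
  obtain ⟨S, hm⟩ := B.exists_localSection m
  obtain ⟨χ, h1, h2⟩ := exists_smooth_bump (EM := EM) S.isOpen_base hm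
  exact ⟨S, χ, hm, h2, h1⟩

/-- Expand χ² k = ∑ c_i v_i in vertical fields with c_i(m) = 0. In [a, c_i v_i] = c_i [a, v_i] +
a(c_i) v_i both coefficients vanish at m, because a projects to zero there; and [a, χ² k] has the
same value at m as [a, k]. -/
theorem lie_mem_kernelVanishingAt {m : M} {a : B.atiyahAlgebra} (ha : a ∈ B.isotropySubalgebra m)
    {k : B.kernelAlgebra} (hk : k ∈ B.kernelVanishingAt m) : ⁅a, k⁆ ∈ B.kernelVanishingAt m := by
  obtain ⟨S, χ, hm, hχ, hχm⟩ := B.exists_cutoff m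
  obtain ⟨c, hc, hc0⟩ := S.exists_sq_smul_eq_sum hχ (Module.finBasis ℝ EG) k
  have h1 := B.lie_smul_kernel_of_atiyah a (χ ^ 2) k
  rw [hc, lie_sum] at h1
  rw [← S.evalHom_eq_zero_iff hm] at hk ⊢
  have h2 := congrArg (S.evalHom hm) h1
  have h3 : (χ ^ 2) m = 1 := by
    change (χ m) ^ 2 = 1
    rw [hχm, one_pow]
  rw [map_add, S.evalHom_smul, S.evalHom_smul, hk, smul_zero, add_zero, h3, one_smul, map_sum] at h2
  rw [← h2]
  refine Finset.sum_eq_zero fun i _ => ?_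
  rw [lie_smul_kernel_of_atiyah, map_add, S.evalHom_smul, S.evalHom_smul,
    hc0 m hm ((S.evalHom_eq_zero_iff hm k).1 hk) i, B.anchorDerivation_apply_eq_zero ha, zero_smul,
    zero_smul, add_zero]

/-- An ideal of the structure Lie algebra defines an ideal of the kernel of the anchor that is
normalized by the isotropy subalgebra. -/
theorem isotropySubalgebra_le_ambientNormalizer_comap
    [LieAlgebra.IsSemisimple ℝ (GroupLieAlgebra 𝓘(ℝ, EG) G)] {S : B.LocalSection} {m : M}
    (hm : m ∈ S.base) (hev : Function.Surjective (S.evalHom hm))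
    (I : LieIdeal ℝ (GroupLieAlgebra 𝓘(ℝ, EG) G)) :
    B.isotropySubalgebra m ≤ B.kernelAlgebra.ambientNormalizer (I.comap (S.evalHom hm)) := by
  intro a ha
  rw [LieIdeal.mem_ambientNormalizer_iff]
  intro k hk
  rw [LieIdeal.mem_comap] at hk ⊢
  -- Since I = [I, I], a derivation preserves I: [η, ζ] goes to a sum of brackets that each have one
  -- factor in I. The argument runs on lifts to 𝒦, avoiding the induced derivation of 𝔤.
  have hlift : ∀ ξ ∈ I, ∃ l, S.evalHom hm l = ξ ∧ S.evalHom hm ⁅a, l⁆ ∈ I := by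
    intro ξ hξ
    rw [← I.lie_self_eq_of_isSemisimple, ← LieSubmodule.mem_toSubmodule,
      LieSubmodule.lieIdeal_oper_eq_linear_span'] at hξ
    induction hξ using Submodule.span_induction with
    | mem ξ h =>
      obtain ⟨η, hη, ζ, hζ, rfl⟩ := h
      obtain ⟨p, rfl⟩ := hev η
      obtain ⟨q, rfl⟩ := hev ζ
      refine ⟨⁅p, q⁆, LieHom.map_lie _ _ _, ?_⟩
      have e : ⁅a, ⁅p, q⁆⁆ = ⁅⁅a, p⁆, q⁆ + ⁅p, ⁅a, q⁆⁆ := Subtype.ext (leibniz_lie a p.1 q.1)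
      rw [e, map_add, LieHom.map_lie, LieHom.map_lie]
      refine I.add_mem (lie_mem_right ℝ _ I _ _ hζ) (lie_mem_left ℝ _ I _ _ hη)
    | zero => exact ⟨0, map_zero _, by rw [lie_zero, map_zero]; exact I.zero_mem⟩
    | add ξ η _ _ h1 h2 =>
      obtain ⟨p, hp, hp'⟩ := h1
      obtain ⟨q, hq, hq'⟩ := h2
      refine ⟨p + q, by rw [map_add, hp, hq], ?_⟩
      rw [lie_add, map_add]
      exact I.add_mem hp' hq'
    | smul c ξ _ h =>
      obtain ⟨p, hp, hp'⟩ := h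
      refine ⟨c • p, by rw [map_smul, hp], ?_⟩
      rw [lie_smul, map_smul]
      exact I.smul_mem c hp'
  obtain ⟨l, hl, hl'⟩ := hlift _ hk
  -- The choice of lift is immaterial, because 𝒜_m preserves 𝒦(m).
  have h0 : k - l ∈ B.kernelVanishingAt m := by
    rw [← S.evalHom_eq_zero_iff hm, map_sub, hl, sub_self]
  have h1 := (S.evalHom_eq_zero_iff hm _).2 (B.lie_mem_kernelVanishingAt ha h0)
  rw [lie_sub, map_sub, sub_eq_zero] at h1
  rw [h1]
  exact hl'

/-- The nonzero value of k at m is missed by some maximal ideal of 𝔤; its preimage under evaluation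
at m is the required J. -/
theorem exists_mem_normalizedMaximalIdeals_notMem
    [LieAlgebra.IsSemisimple ℝ (GroupLieAlgebra 𝓘(ℝ, EG) G)] {m : M} {k : B.kernelAlgebra}
    (hk : k ∉ B.kernelVanishingAt m) :
    ∃ J ∈ B.normalizedMaximalIdeals (B.isotropySubalgebra m), k ∉ J := by
  obtain ⟨S, χ, hm, hχ, hχm⟩ := B.exists_cutoff m
  have hev : Function.Surjective (S.evalHom hm) := fun ξ =>
    ⟨S.vertical hχ ξ, by rw [S.evalHom_vertical, hχm, one_smul]⟩
  have : FiniteDimensional ℝ (GroupLieAlgebra 𝓘(ℝ, EG) G) :=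
    inferInstanceAs (FiniteDimensional ℝ EG)
  rw [← S.evalHom_eq_zero_iff hm] at hk
  obtain ⟨I, hI, hkI⟩ := LieIdeal.exists_isCoatom_notMem hk
  exact ⟨I.comap (S.evalHom hm), ⟨LieIdeal.isMaximalFiniteCodim_comap hev hI,
    B.isotropySubalgebra_le_ambientNormalizer_comap hm hev I⟩, fun h => hkI (LieIdeal.mem_comap.1 h)⟩

theorem isCoalgebraic_multiplierIdeal_of_mem [SecondCountableTopology M]
    (hM : 0 < Module.finrank ℝ EM) {m : M} {J : LieIdeal ℝ B.kernelAlgebra}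
    (hJ : J ∈ B.normalizedMaximalIdeals (B.isotropySubalgebra m)) :
    (multiplierIdeal C^∞⟮𝓘(ℝ, EM), M; ℝ⟯ J.toSubmodule).IsCoalgebraic := by
  obtain ⟨a, h, hu⟩ := B.exists_isUnit_sum_sq hM
  exact isCoalgebraic_multiplierIdeal_lieIdeal B.anchorDerivation B.coe_smul_kernel B.lie_smul_eq
    (fun k hk => B.anchorDerivation_eq_zero hk) hJ.1.2.1 (B.cofg_isotropySubalgebra m) hJ.2 a h hu

theorem ambientNormalizer_le_isotropySubalgebra [SecondCountableTopology M]
    (hM : 0 < Module.finrank ℝ EM) {m : M} {J : LieIdeal ℝ B.kernelAlgebra}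
    (hJ : J ∈ B.normalizedMaximalIdeals (B.isotropySubalgebra m)) {x : M}
    (hx : ∀ f ∈ multiplierIdeal C^∞⟮𝓘(ℝ, EM), M; ℝ⟯ J.toSubmodule, f x = 0) :
    B.kernelAlgebra.ambientNormalizer J ≤ B.isotropySubalgebra x := fun _ ha =>
  B.mem_isotropySubalgebra_of_derivation_mem (B.isCoalgebraic_multiplierIdeal_of_mem hM hJ) hx
    fun _ hf => derivation_mem_multiplierIdeal_lieIdeal B.anchorDerivation B.coe_smul_kernel
      B.lie_smul_eq ha hf

theorem eq_of_forall_mem_multiplierIdeal [SecondCountableTopology M]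
    (hM : 0 < Module.finrank ℝ EM) {m : M} {J : LieIdeal ℝ B.kernelAlgebra}
    (hJ : J ∈ B.normalizedMaximalIdeals (B.isotropySubalgebra m)) {x : M}
    (hx : ∀ f ∈ multiplierIdeal C^∞⟮𝓘(ℝ, EM), M; ℝ⟯ J.toSubmodule, f x = 0) : x = m :=
  B.eq_of_isotropySubalgebra_le hM
    (hJ.2.trans (B.ambientNormalizer_le_isotropySubalgebra hM hJ hx))

theorem multiplierIdeal_ne_top {m : M} {J : LieIdeal ℝ B.kernelAlgebra}
    (hJ : J ∈ B.normalizedMaximalIdeals (B.isotropySubalgebra m)) :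
    multiplierIdeal C^∞⟮𝓘(ℝ, EM), M; ℝ⟯ J.toSubmodule ≠ ⊤ := fun htop => by
  refine hJ.1.1 (eq_top_iff.2 fun k _ => ?_)
  have h1 : (1 : C^∞⟮𝓘(ℝ, EM), M; ℝ⟯) ∈ multiplierIdeal C^∞⟮𝓘(ℝ, EM), M; ℝ⟯ J.toSubmodule :=
    htop ▸ Submodule.mem_top
  simpa using mem_multiplierIdeal.1 h1 k

/-- At a common zero x of the multiplier ideal of J, 𝒜_m ≤ N(J) ≤ 𝒜_x. Distinct points have
incomparable isotropy subalgebras, so x = m and equality holds. -/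
theorem ambientNormalizer_eq [SecondCountableTopology M]
    (hM : 0 < Module.finrank ℝ EM) {m : M} {J : LieIdeal ℝ B.kernelAlgebra}
    (hJ : J ∈ B.normalizedMaximalIdeals (B.isotropySubalgebra m)) :
    B.kernelAlgebra.ambientNormalizer J = B.isotropySubalgebra m := by
  have : LocallyCompactSpace M := ChartedSpace.locallyCompactSpace EM M
  obtain ⟨x, hx⟩ := exists_forall_mem_eq_zero (B.isCoalgebraic_multiplierIdeal_of_mem hM hJ)
    (B.multiplierIdeal_ne_top hJ)
  have hxm := B.eq_of_forall_mem_multiplierIdeal hM hJ hx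
  subst hxm
  exact le_antisymm (B.ambientNormalizer_le_isotropySubalgebra hM hJ hx) hJ.2

/-- Once J is known to contain f • 𝒦 for every f with f(m) = 0, write k = χ² k + (1 − χ²) k with
χ(m) = 1. The first term is a combination of vertical fields with coefficients vanishing at m, and
the factor of the second vanishes at m. -/
theorem kernelVanishingAt_le [SecondCountableTopology M]
    [LieAlgebra.IsSemisimple ℝ (GroupLieAlgebra 𝓘(ℝ, EG) G)]
    (hM : 0 < Module.finrank ℝ EM) {m : M} {J : LieIdeal ℝ B.kernelAlgebra}
    (hJ : J ∈ B.normalizedMaximalIdeals (B.isotropySubalgebra m)) :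
    B.kernelVanishingAt m ≤ J.toSubmodule := by
  have : LocallyCompactSpace M := ChartedSpace.locallyCompactSpace EM M
  obtain ⟨S, χ, hm, hχ, hχm⟩ := B.exists_cutoff m
  have hco := B.isCoalgebraic_multiplierIdeal_of_mem hM hJ
  have hzero := fun x hx => B.eq_of_forall_mem_multiplierIdeal hM hJ (x := x) hx
  -- If [𝒦, 𝒦] were inside J, then χ³ would be in the multiplier ideal. It is nonzero at the only
  -- possible zero m, so it can be cancelled, leaving 1 in a proper ideal.
  have hperf : ∃ k l : B.kernelAlgebra, ⁅k, l⁆ ∉ J := by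
    by_contra! h
    have h1 := S.cube_mem_multiplierIdeal hχ (J := J.toSubmodule) h
    have h2 : (χ ^ 3) m ≠ 0 := by
      change (χ m) ^ 3 ≠ 0
      rw [hχm, one_pow]
      exact one_ne_zero
    rw [← mul_one (χ ^ 3)] at h1
    exact B.multiplierIdeal_ne_top hJ ((Ideal.eq_top_iff_one _).2
      (mem_of_mul_mem_of_coalgebraic hco hzero h2 h1))
  have hsmul := fun (f : C^∞⟮𝓘(ℝ, EM), M; ℝ⟯) (k : B.kernelAlgebra) (hk : k ∈ J) =>
    hJ.1.smul_mem_of_mem (fun f k l => B.lie_smul_kernel f k l) hperf f hk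
  have hvan : ∀ f : C^∞⟮𝓘(ℝ, EM), M; ℝ⟯, f m = 0 → ∀ k : B.kernelAlgebra, f • k ∈ J := by
    intro f hf
    -- Coalgebraicity only yields a power of f; maximality of J removes the exponent.
    obtain ⟨n, hn⟩ := exists_pow_mem_of_coalgebraic hco hzero hf
    exact hJ.1.smul_mem_of_pow (fun f k l => B.lie_smul_kernel f k l) hsmul f n
      (mem_multiplierIdeal.1 hn)
  intro k hk
  obtain ⟨c, hc, hc0⟩ := S.exists_sq_smul_eq_sum hχ (Module.finBasis ℝ EG) k
  have h1 : χ ^ 2 • k ∈ J := by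
    rw [hc]
    exact J.toSubmodule.sum_mem fun i _ => hvan _ (hc0 m hm hk i) _
  have h2 : (1 - χ ^ 2) • k ∈ J := by
    refine hvan _ ?_ k
    change 1 - (χ m) ^ 2 = 0
    rw [hχm, one_pow, sub_self]
  have h3 := J.add_mem h1 h2
  rwa [← add_smul, add_sub_cancel, one_smul] at h3

end SmoothPrincipalBundle

/-! ### The main theorem. -/

theorem mainTheorem8
    {EM EG EP : Type*}
    [NormedAddCommGroup EM] [NormedSpace ℝ EM] [FiniteDimensional ℝ EM]
    [NormedAddCommGroup EG] [NormedSpace ℝ EG] [FiniteDimensional ℝ EG]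
    [NormedAddCommGroup EP] [NormedSpace ℝ EP] [FiniteDimensional ℝ EP]
    {M G P : Type*}
    [TopologicalSpace M] [T2Space M] [SecondCountableTopology M]
    [ChartedSpace EM M] [IsManifold 𝓘(ℝ, EM) ∞ M]
    [TopologicalSpace G] [T2Space G] [SecondCountableTopology G]
    [ChartedSpace EG G] [Group G] [LieGroup 𝓘(ℝ, EG) ∞ G]
    [TopologicalSpace P] [T2Space P] [SecondCountableTopology P]
    [ChartedSpace EP P] [IsManifold 𝓘(ℝ, EP) ∞ P]
    (hM : 0 < Module.finrank ℝ EM)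
    (hG : LieAlgebra.HasTrivialRadical ℝ (GroupLieAlgebra 𝓘(ℝ, EG) G))
    (B : SmoothPrincipalBundle EM EG EP M G P) :
    (∀ m : M, (B.isotropySubalgebra m).IsMaximalFiniteCodim) ∧
    ∀ T : LieSubalgebra ℝ B.atiyahAlgebra, T.IsMaximalFiniteCodim →
      ∃ m : M, (∀ m' : M, T = B.isotropySubalgebra m' ↔ m' = m) ∧
        (sInf (B.normalizedMaximalIdeals T)).toSubmodule = B.kernelVanishingAt m ∧
        ∀ J ∈ B.normalizedMaximalIdeals T, B.kernelAlgebra.ambientNormalizer J = T := by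
  have : FiniteDimensional ℝ (GroupLieAlgebra 𝓘(ℝ, EG) G) :=
    inferInstanceAs (FiniteDimensional ℝ EG)
  -- Cartan's criterion: trivial radical gives a nondegenerate Killing form, which in turn supplies
  -- the decomposition into simple ideals used by the lemmas on 𝔤.
  have : LieAlgebra.IsKilling ℝ (GroupLieAlgebra 𝓘(ℝ, EG) G) := inferInstance
  refine ⟨B.isMaximalFiniteCodim_isotropySubalgebra hM, fun T hT => ?_⟩
  obtain ⟨m, hTm⟩ := B.exists_le_isotropySubalgebra hM hT.1 hT.2.1
  obtain rfl : T = B.isotropySubalgebra m := by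
    by_contra hne
    exact hT.2.2 _ (B.isotropySubalgebra_ne_top hM m) (B.cofg_isotropySubalgebra m)
      (lt_of_le_of_ne hTm hne)
  refine ⟨m, fun m' => ⟨fun h => B.eq_of_isotropySubalgebra_le hM h.le, fun h => h ▸ rfl⟩, ?_,
    fun J hJ => B.ambientNormalizer_eq hM hJ⟩
  apply le_antisymm
  · intro k hk
    by_contra h
    obtain ⟨J, hJ, hkJ⟩ := B.exists_mem_normalizedMaximalIdeals_notMem h
    exact hkJ (sInf_le hJ hk)
  · rw [LieSubmodule.sInf_toSubmodule]
    refine le_sInf ?_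
    rintro _ ⟨J, hJ, rfl⟩
    exact B.kernelVanishingAt_le hM hJ
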